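/- **Setting.** Functions of the KP times $t=(t_1\equiv x,t_2,\dots)$ form a commutative $\mathbb Q$-algebra $R$ with commuting derivations $\partial/\partial t_n$; $\partial=\partial/\partial x$. Let $r\ge 1$, $m\ge 0$, and let $$L=D^r+\sum_{l=0}^{r-2}u_lD^l+\sum_{i=1}^m\Phi_iD^{-1}\Psi_i$$ be a Lax operator of the constrained KP hierarchy ${\sf cKP}_{r,m}$ with tau-function $\tau$: $\partial L/\partial t_n=[L^{n/r}_+,L]$, $\partial\Phi_i/\partial t_n=L^{n/r}_+(\Phi_i)$, $\partial\Psi_i/\partial t_n=-(L^*)^{n/r}_+(\Psi_i)$, and $W=\sum_{n\ge0}\frac{p_n(-[\partial])\tau}{\tau}D^{-n}$ satisfies $LW=WD^r$ and $\partial W/\partial t_n=L^{n/r}_+W-WD^n$, where $\tau$ is invertible, $p_n$ are the Schur polynomials and $[\partial]=(\partial_{t_1},\frac12\partial_{t_2},\frac13\partial_{t_3},\dots)$. A squared eigenfunction potential (SEP) of an eigenfunction $\Phi$ and an adjoint eigenfunction $\Psi$ is a function $S(\Phi,\Psi)$ with $\partial S(\Phi,\Psi)/\partial t_n={\rm Res}(D^{-1}\Psi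 L^{n/r}_+\Phi D^{-1})$ for all $n\ge1$, in particular $\partial S(\Phi,\Psi)=\Phi\Psi$; it is determined up to an additive constant. Put $\chi_i^{(k)}=L^k(\Phi_i)$, $\chi_j^{*(l)}=(L^*)^l(\Psi_j)$, where $L(f)=L_+(f)+\sum_b\Phi_bS(f,\Psi_b)$ and $L^*(g)=L_+^*(g)-\sum_b\Psi_bS(\Phi_b,g)$. Let SEPs of all pairs $f=\chi_i^{(k)}$, $g=\chi_j^{*(l)}$ be chosen, with constants such that $$\frac{\partial S(f,g)}{\partial t_r}=S(L(f),g)-S(f,L^*(g))-\sum_bS(f,\Psi_b)S(\Phi_b,g).$$ **DB steps.** The Darboux–Bäcklund (DB) step in $\Phi_a$ (defined if $\Phi_a$ is invertible) is, with $T=\Phi_aD\Phi_a^{-1}$: $L\mapsto TLT^{-1}$, $\tau\mapsto\Phi_a\tau$, $\Phi_a\mapsto T(L(\Phi_a))$, $\Psi_a\mapsto1/\Phi_a$, and $\Phi_i\mapsto T(\Phi_i)$, $\Psi_i\mapsto T^{*-1}(\Psi_i)=-S(\Phi_a,\Psi_i)/\Phi_a$ for $i\ne a$. The adjoint DB step in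 $\Psi_b$ (defined if $\Psi_b$ is invertible) is, with $\bar T=\Psi_bD\Psi_b^{-1}$: $L\mapsto\bar T^{*-1}L\bar T^*$, $\tau\mapsto\Psi_b\tau$, $\Phi_b\mapsto-1/\Psi_b$, $\Psi_b\mapsto\bar T(L^*(\Psi_b))$, and $\Phi_i\mapsto\bar T^{*-1}(\Phi_i)=-S(\Phi_i,\Psi_b)/\Psi_b$, $\Psi_i\mapsto\bar T(\Psi_i)$ for $i\ne b$. The SEPs are carried along by $$S(T(f),T^{*-1}(g))=S(f,g)-\frac{f\,S(\Phi_a,g)}{\Phi_a},\qquad S(T(f),1/\Phi_a)=\frac f{\Phi_a},$$ $$S(\bar T^{*-1}(f),\bar T(g))=S(f,g)-\frac{S(f,\Psi_b)\,g}{\Psi_b},\qquad S(-1/\Psi_b,\bar T(g))=-\frac g{\Psi_b}.$$ **Determinants.** $W[f_1,\dots,f_k]=\det\|\partial^{\alpha-1}f_\beta\|$, with $W[\,]=1$. For $N\ge1$, $\widetilde W[f_1,\dots,f_N;g]$ is the $N\times N$ determinant with rows $(\partial^{\alpha-1}f_1,\dots,\partial^{\alpha-1}f_N)$, $1\le\alpha\le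 N-1$, and last row $(S(f_1,g),\dots,S(f_N,g))$; $\widetilde W[\,;g]=-g$. **Proposition.** Let $0\le a\le m$ and let $n_1,\dots,n_a,k_{a+1},\dots,k_m\ge 0$ be integers, $$(\vec n,\vec k)=((n_1,\dots,n_a,0,\dots,0),(0,\dots,0,k_{a+1},\dots,k_m)).$$ Starting from $(L,\Phi,\Psi,\tau)$, perform $n_1$ DB steps in $\Phi_1$, ..., $n_a$ DB steps in $\Phi_a$, then $k_{a+1}$ adjoint DB steps in $\Psi_{a+1}$, ..., $k_m$ adjoint DB steps in $\Psi_m$, and assume that each of these steps is defined. Then the resulting Lax operator is again of the form $D^r+\sum_{l=0}^{r-2}\tilde u_lD^l+\sum_{i=1}^m\tilde\Phi_iD^{-1}\tilde\Psi_i$ with the resulting functions $\tilde\Phi_i,\tilde\Psi_i$; the resulting potentials satisfy $\partial S(f,g)=fg$ on all pairs $f=\tilde L^k(\tilde\Phi_i)$, $g=(\tilde L^*)^l(\tilde\Psi_j)$; the Wronskian $$W_{\vec n}=W\big[\chi_1^{(0)},\dots,\chi_1^{(n_1-1)},\dots,\chi_a^{(0)},\dots,\chi_a^{(n_a-1)}\big]$$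 is invertible; and the resulting tau-function $\tau^{(\vec n,\vec k)}$ is given by $$\frac{\tau^{(\vec n,\vec k)}}{\tau}=W_{\vec n}\,\big(-W_{\vec n}\big)^{-\sum_{j=a+1}^mk_j}\;W\big[\Delta^{\vec n}_{(0,a+1)},\dots,\Delta^{\vec n}_{(k_{a+1}-1,a+1)},\dots,\Delta^{\vec n}_{(0,m)},\dots,\Delta^{\vec n}_{(k_m-1,m)}\big],$$ $$\Delta^{\vec n}_{(l,s)}=\widetilde W\big[\chi_1^{(0)},\dots,\chi_1^{(n_1-1)},\dots,\chi_a^{(0)},\dots,\chi_a^{(n_a-1)};\chi_s^{*(l)}\big].$$ -/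

import Mathlib

/-!
Conventions.  Functions of the multi-time `t = (t₁ = x, t₂, …)` are the elements of a commutative
`ℚ`-algebra `R`; the time derivatives `∂/∂t_n`, `n ≥ 1`, are commuting derivations `d n` of `R`
(the value `d 0` is never used), and `D = d 1` is the derivative in `x`.  "Nowhere zero" is
"unit of `R`"; `Ring.inverse` is only used at units.
-/

noncomputable section

namespace CKP

variable {R : Type*} [CommRing R] [Algebra ℚ R]

/-! ### Pseudo-differential operators -/

/-- Formal pseudo-differential operators `∑_{n ≤ N} a_n D^n` with coefficients in `R`. -/
@[ext]
structure PDO (R : Type*) [CommRing R] where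
  coeff : ℤ → R
  bounded : ∃ N : ℤ, ∀ n, N < n → coeff n = 0

namespace PDO

/-- The operator `f D^n`. -/
def mono (n : ℤ) (f : R) : PDO R where
  coeff k := if k = n then f else 0
  bounded := ⟨n, fun k hk => by rw [if_neg (by omega)]⟩

/-- Coefficient of `D^n` in `A B`, from the generalized Leibniz rule
`D^i f = ∑_{k ≥ 0} (i choose k) (∂^k f) D^{i-k}`, `i ∈ ℤ`.  The sum runs over `p = (i, k)` and has
finitely many nonzero terms. -/
def mulCoeff (D : Derivation ℚ R R) (A B : PDO R) (n : ℤ) : R :=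
  ∑ᶠ p : ℤ × ℕ, (Ring.choose p.1 p.2 : ℤ) • (A.coeff p.1 * D^[p.2] (B.coeff (n - p.1 + p.2)))

/-- The product of pseudo-differential operators. -/
def mul (D : Derivation ℚ R R) (A B : PDO R) : PDO R where
  coeff := mulCoeff D A B
  bounded := by
    obtain ⟨N, hN⟩ := A.bounded
    obtain ⟨M, hM⟩ := B.bounded
    refine ⟨N + M, fun n hn => finsum_eq_zero_of_forall_eq_zero fun p => ?_⟩
    by_cases h : N < p.1
    · rw [hN _ h, zero_mul, smul_zero]
    · rw [hM (n - p.1 + p.2) (by omega), iterate_map_zero, mul_zero, smul_zero]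

/-- Powers of a pseudo-differential operator. -/
def pow (D : Derivation ℚ R R) (A : PDO R) : ℕ → PDO R
  | 0 => mono 0 1
  | n + 1 => mul D (pow D A n) A

/-- The differential part `A₊ = ∑_{n ≥ 0} a_n D^n`. -/
def plus (A : PDO R) : PDO R where
  coeff n := if 0 ≤ n then A.coeff n else 0
  bounded := by
    obtain ⟨N, hN⟩ := A.bounded
    exact ⟨N, fun n hn => by rw [hN n hn, ite_self]⟩

/-- Action of the differential part on a function: `A₊(f) = ∑_{k ≥ 0} a_k ∂^k f`. -/
def act (D : Derivation ℚ R R) (A : PDO R) (f : R) : R :=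
  ∑ᶠ k : ℕ, A.coeff k * D^[k] f

/-- Action of the formal adjoint of the differential part: `A₊^*(f) = ∑_{k ≥ 0} (-∂)^k (a_k f)`. -/
def actAdj (D : Derivation ℚ R R) (A : PDO R) (f : R) : R :=
  ∑ᶠ k : ℕ, (-1) ^ k * D^[k] (A.coeff k * f)

/-- The residue, i.e. the coefficient of `D⁻¹`. -/
def res (A : PDO R) : R := A.coeff (-1)

end PDO

/-- `Res (D⁻¹ Ψ P Φ D⁻¹)`, the flux entering the definition of squared eigenfunction potentials. -/
def sepFlux (D : Derivation ℚ R R) (P : PDO R) (Φ Ψ : R) : R :=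
  (PDO.mul D (PDO.mul D (PDO.mul D (PDO.mul D (PDO.mono (-1) 1) (PDO.mono 0 Ψ)) P)
    (PDO.mono 0 Φ)) (PDO.mono (-1) 1)).res

/-! ### Wronskians and Wronskian-like determinants -/

/-- `W[f₁, …, f_k] = det ‖∂^{α-1} f_β‖`; the empty Wronskian is `1`. -/
def wronskian (D : Derivation ℚ R R) (fs : List R) : R :=
  (Matrix.of fun α β : Fin fs.length => D^[α.val] (fs.get β)).det

/-- `W̃[f₁, …, f_N; g]`: the determinant whose first `N - 1` rows are
`(∂^{α-1} f_1, …, ∂^{α-1} f_N)` and whose last row is `(S(f_1, g), …, S(f_N, g))`.  The first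
argument is the list of pairs `(f_β, S(f_β, g))`.  For `N = 0` the value is `-g`, the one for which
`∂ (W̃[f₁,…,f_{N+1}; g] / W[f₁,…,f_N]) W[f₁,…,f_N]² = - W̃[f₁,…,f_N; g] W[f₁,…,f_{N+1}]`
holds for `N = 0` too. -/
def wronskianTilde (D : Derivation ℚ R R) (fs : List (R × R)) (g : R) : R :=
  if fs.length = 0 then -g
  else (Matrix.of fun α β : Fin fs.length =>
    if α.val + 1 < fs.length then D^[α.val] (fs.get β).1 else (fs.get β).2).det

/-! ### Lax operators with their eigenfunctions, SEPs and tau-function -/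

/-- A Lax operator `L`, functions `Φ_i`, `Ψ_i` (`i = 1, …, m`), a choice
`S i k j l = S(L^k(Φ_i), (L^*)^l(Ψ_j))` of the squared eigenfunction potentials (each of them is
determined by its two arguments up to an additive constant only), and a function `τ`. -/
structure System (m : ℕ) (R : Type*) [CommRing R] where
  L : PDO R
  Φ : Fin m → R
  Ψ : Fin m → R
  S : Fin m → ℕ → Fin m → ℕ → R
  τ : R

namespace System

variable {m : ℕ}

/-- `χ_i^{(k)} = L^k(Φ_i)`, where `L(f) = L₊(f) + ∑_b Φ_b S(f, Ψ_b)`. -/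
def chi (D : Derivation ℚ R R) (s : System m R) (i : Fin m) : ℕ → R
  | 0 => s.Φ i
  | k + 1 => s.L.act D (chi D s i k) + ∑ b, s.Φ b * s.S i k b 0

/-- `χ_j^{*(l)} = (L^*)^l(Ψ_j)`, where `L^*(g) = L₊^*(g) - ∑_b Ψ_b S(Φ_b, g)`. -/
def chiStar (D : Derivation ℚ R R) (s : System m R) (j : Fin m) : ℕ → R
  | 0 => s.Ψ j
  | l + 1 => s.L.actAdj D (chiStar D s j l) - ∑ b, s.Ψ b * s.S b 0 j l

/-- `L = D^r + ∑_{l=0}^{r-2} u_l D^l + ∑_{a=1}^m Φ_a D⁻¹ Ψ_a`. -/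
structure HasLaxForm (D : Derivation ℚ R R) (r : ℕ) (s : System m R) : Prop where
  lead : s.L.coeff r = 1
  high : ∀ n : ℤ, (r : ℤ) < n → s.L.coeff n = 0
  sub : s.L.coeff (r - 1) = 0
  neg : ∀ n : ℤ, n < 0 →
    s.L.coeff n = ∑ a, (PDO.mul D (PDO.mono (-1) (s.Φ a)) (PDO.mono 0 (s.Ψ a))).coeff n

/-- `S i k j l` is a primitive in `x` of `χ_i^{(k)} χ_j^{*(l)}`. -/
def IsPrimitive (D : Derivation ℚ R R) (s : System m R) : Prop :=
  ∀ i k j l, D (s.S i k j l) = s.chi D i k * s.chiStar D j l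

end System

/-- `Q = L^{1/r}`: a monic operator of order one with `Q^r = L`. -/
structure IsRoot (D : Derivation ℚ R R) (r : ℕ) (L Q : PDO R) : Prop where
  lead : Q.coeff 1 = 1
  high : ∀ n : ℤ, 1 < n → Q.coeff n = 0
  pow_eq : PDO.pow D Q r = L

/-- `p_n(-[∂]) f`, where `[∂] = (∂/∂t₁, ½ ∂/∂t₂, ⅓ ∂/∂t₃, …)` and `p_n` are the Schur polynomials
`exp(∑_{l ≥ 1} λ^l t_l) = ∑_n λ^n p_n(t)`.  The sum over compositions of `n` is the coefficient of
`λ^n` in `∑_k (∑_l λ^l t_l)^k / k!`. -/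
def schurNeg (d : ℕ → Derivation ℚ R R) (n : ℕ) (f : R) : R :=
  ∑ c : Composition n, ((c.length.factorial : ℚ)⁻¹ •
    (c.blocks.map fun l : ℕ => (-(l : ℚ)⁻¹) • ((d l : R →ₗ[ℚ] R) : Module.End ℚ R)).prod) f

/-- The operator `W = ∑_{n ≥ 0} (p_n(-[∂]) τ / τ) D^{-n}`. -/
def dressing (d : ℕ → Derivation ℚ R R) (τ : R) : PDO R where
  coeff j := if j ≤ 0 then Ring.inverse τ * schurNeg d (-j).toNat τ else 0
  bounded := ⟨0, fun j hj => by rw [if_neg (by omega)]⟩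

/-- A system of the `cKP_{r,m}` hierarchy together with a tau-function: `Q = L^{1/r}`, so that
`(Q^n)₊ = L^{n/r}₊`. -/
structure IsCKP {m : ℕ} (d : ℕ → Derivation ℚ R R) (r : ℕ) (s : System m R) (Q : PDO R) :
    Prop where
  form : s.HasLaxForm (d 1) r
  root : IsRoot (d 1) r s.L Q
  /-- `∂L/∂t_n = [L^{n/r}₊, L]` -/
  lax : ∀ n, 1 ≤ n → ∀ j, d n (s.L.coeff j) =
    (PDO.mul (d 1) (PDO.pow (d 1) Q n).plus s.L).coeff j
      - (PDO.mul (d 1) s.L (PDO.pow (d 1) Q n).plus).coeff j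
  /-- `∂Φ_i/∂t_n = L^{n/r}₊(Φ_i)` -/
  eigen : ∀ n, 1 ≤ n → ∀ i, d n (s.Φ i) = (PDO.pow (d 1) Q n).act (d 1) (s.Φ i)
  /-- `∂Ψ_i/∂t_n = -(L^*)^{n/r}₊(Ψ_i)` -/
  adjEigen : ∀ n, 1 ≤ n → ∀ i, d n (s.Ψ i) = -(PDO.pow (d 1) Q n).actAdj (d 1) (s.Ψ i)
  /-- `∂S(Φ, Ψ)/∂t_n = Res (D⁻¹ Ψ L^{n/r}₊ Φ D⁻¹)` -/
  sep : ∀ n, 1 ≤ n → ∀ i k j l, d n (s.S i k j l) =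
    sepFlux (d 1) (PDO.pow (d 1) Q n).plus (s.chi (d 1) i k) (s.chiStar (d 1) j l)
  tau_unit : IsUnit s.τ
  /-- `L = W D^r W⁻¹` -/
  dress : PDO.mul (d 1) s.L (dressing d s.τ) = PDO.mul (d 1) (dressing d s.τ) (PDO.mono r 1)
  /-- `∂W/∂t_n = L^{n/r}₊ W - W D^n` -/
  sato : ∀ n, 1 ≤ n → ∀ j, d n ((dressing d s.τ).coeff j) =
    (PDO.mul (d 1) (PDO.pow (d 1) Q n).plus (dressing d s.τ)).coeff j
      - (PDO.mul (d 1) (dressing d s.τ) (PDO.mono n 1)).coeff j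

/-- Normalization of the integration constants of the SEPs: the identity
`∂S(f,g)/∂t_r = S(L(f), g) - S(f, L^*(g)) - ∑_b S(f, Ψ_b) S(Φ_b, g)`, which holds up to an additive
constant for arbitrary SEPs, holds exactly for `f = χ_i^{(k)}`, `g = χ_j^{*(l)}`. -/
def IsNormalized {m : ℕ} (d : ℕ → Derivation ℚ R R) (r : ℕ) (s : System m R) : Prop :=
  ∀ i k j l, d r (s.S i k j l) =
    s.S i (k + 1) j l - s.S i k j (l + 1) - ∑ b, s.S i k b 0 * s.S b 0 j l

/-! ### Darboux-Bäcklund transformations -/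

/-- `T(f) = φ ∂ (φ⁻¹ f)`, i.e. the action of `T = φ D φ⁻¹`. -/
def gauge (D : Derivation ℚ R R) (φ f : R) : R := φ * D (Ring.inverse φ * f)

/-- The DB transformation with `T = Φ_a D Φ_a⁻¹`:
* `L ↦ T L T⁻¹`, `τ ↦ Φ_a τ`;
* `Φ_a ↦ T(L(Φ_a))`, `Ψ_a ↦ 1/Φ_a`;
* `Φ_i ↦ T(Φ_i)`, `Ψ_i ↦ T^{*-1}(Ψ_i) = -S(Φ_a, Ψ_i)/Φ_a` for `i ≠ a`.

It maps `χ_i^{(k)}` to the function with label `(i, k)` if `i ≠ a` and `(a, k-1)` if `i = a`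
(label shift), and `χ_j^{*(l)}` to the one with label `(j, l)` if `j ≠ a` and `(a, l+1)` if `j = a`.
The SEPs of the new functions are the primitives
`S(T(f), T^{*-1}(g)) = S(f, g) - f S(Φ_a, g)/Φ_a` and `S(T(f), 1/Φ_a) = f/Φ_a`. -/
def db {m : ℕ} (D : Derivation ℚ R R) (a : Fin m) (s : System m R) : System m R :=
  let φ := s.Φ a
  let φinv := Ring.inverse φ
  let f : Fin m → ℕ → R := fun i k => s.chi D i (if i = a then k + 1 else k)
  let Sf : Fin m → ℕ → Fin m → ℕ → R := fun i k => s.S i (if i = a then k + 1 else k)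
  { L := PDO.mul D (PDO.mul D (PDO.mul D (PDO.mono 1 φ) (PDO.mono 0 φinv)) s.L)
      (PDO.mul D (PDO.mono (-1) φ) (PDO.mono 0 φinv))
    Φ := fun i => gauge D φ (f i 0)
    Ψ := fun i => if i = a then φinv else -(φinv * s.S a 0 i 0)
    S := fun i k j l =>
      if j = a then
        match l with
        | 0 => φinv * f i k
        | l + 1 => Sf i k a l - φinv * f i k * s.S a 0 a l
      else Sf i k j l - φinv * f i k * s.S a 0 j l
    τ := φ * s.τ }

/-- The adjoint DB transformation with `T̄ = Ψ_b D Ψ_b⁻¹`, so that `T̄^* = -Ψ_b⁻¹ D Ψ_b` and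
`T̄^{*-1} = -Ψ_b⁻¹ D⁻¹ Ψ_b`:
* `L ↦ T̄^{*-1} L T̄^*`, `τ ↦ Ψ_b τ`;
* `Φ_b ↦ -1/Ψ_b`, `Ψ_b ↦ T̄(L^*(Ψ_b))`;
* `Φ_i ↦ T̄^{*-1}(Φ_i) = -S(Φ_i, Ψ_b)/Ψ_b`, `Ψ_i ↦ T̄(Ψ_i)` for `i ≠ b`.

The SEPs of the new functions (with the label shift for the index `b`) are the primitives
`S(T̄^{*-1}(f), T̄(g)) = S(f, g) - S(f, Ψ_b) g/Ψ_b` and `S(-1/Ψ_b, T̄(g)) = -g/Ψ_b`. -/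
def adb {m : ℕ} (D : Derivation ℚ R R) (b : Fin m) (s : System m R) : System m R :=
  let ψ := s.Ψ b
  let ψinv := Ring.inverse ψ
  let g : Fin m → ℕ → R := fun j l => s.chiStar D j (if j = b then l + 1 else l)
  let Sg : Fin m → ℕ → Fin m → ℕ → R := fun i k j l => s.S i k j (if j = b then l + 1 else l)
  { L := PDO.mul D (PDO.mul D (PDO.mul D (PDO.mono (-1) (-ψinv)) (PDO.mono 0 ψ)) s.L)
      (PDO.mul D (PDO.mono 1 (-ψinv)) (PDO.mono 0 ψ))
    Φ := fun i => if i = b then -ψinv else -(ψinv * s.S i 0 b 0)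
    Ψ := fun j => gauge D ψ (g j 0)
    S := fun i k j l =>
      if i = b then
        match k with
        | 0 => -(ψinv * g j l)
        | k + 1 => Sg b k j l - s.S b k b 0 * (ψinv * g j l)
      else Sg i k j l - s.S i k b 0 * (ψinv * g j l)
    τ := ψ * s.τ }

/-- A step: a DB transformation with respect to `Φ_a` or an adjoint one with respect to `Ψ_b`. -/
inductive Step (m : ℕ) where
  | db (a : Fin m)
  | adb (b : Fin m)

/-- The system obtained by one step. -/
def Step.apply {m : ℕ} (D : Derivation ℚ R R) : Step m → System m R → System m R
  | .db a, s => CKP.db D a s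
  | .adb b, s => CKP.adb D b s

/-- The function by which a step divides. -/
def Step.pivot {m : ℕ} : Step m → System m R → R
  | .db a, s => s.Φ a
  | .adb b, s => s.Ψ b

/-- The system obtained by performing the steps of a list from left to right. -/
def run {m : ℕ} (D : Derivation ℚ R R) : List (Step m) → System m R → System m R
  | [], s => s
  | x :: xs, s => run D xs (x.apply D s)

/-- All steps of the list are defined: no step divides by a non-unit. -/
def Admissible {m : ℕ} (D : Derivation ℚ R R) : List (Step m) → System m R → Prop
  | [], _ => True
  | x :: xs, s => IsUnit (x.pivot s) ∧ Admissible D xs (x.apply D s)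

/-- The steps indicated by the superscript `(n, k)`: `n_1` DB transformations with respect to
`Φ_1`, …, `n_m` with respect to `Φ_m`, then `k_1` adjoint DB transformations with respect to `Ψ_1`,
…, `k_m` with respect to `Ψ_m`. -/
def steps {m : ℕ} (n k : Fin m → ℕ) : List (Step m) :=
  ((List.finRange m).flatMap fun i => List.replicate (n i) (Step.db i)) ++
    (List.finRange m).flatMap fun i => List.replicate (k i) (Step.adb i)

/-- The labels `(1,0), …, (1,n_1-1), …, (m,0), …, (m,n_m-1)`. -/
def labels {m : ℕ} (n : Fin m → ℕ) : List (Fin m × ℕ) :=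
  (List.finRange m).flatMap fun i => (List.range (n i)).map fun l => (i, l)

/-- `W[χ_1^{(0)}, …, χ_1^{(n_1-1)}, …, χ_m^{(0)}, …, χ_m^{(n_m-1)}]`. -/
def chiWronskian {m : ℕ} (D : Derivation ℚ R R) (s : System m R) (n : Fin m → ℕ) : R :=
  wronskian D ((labels n).map fun p => s.chi D p.1 p.2)

/-- `Δ^n_{(l,j)} = W̃[χ_1^{(0)}, …, χ_m^{(n_m-1)}; χ_j^{*(l)}]`. -/
def Delta {m : ℕ} (D : Derivation ℚ R R) (s : System m R) (n : Fin m → ℕ) (j : Fin m) (l : ℕ) : R :=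
  wronskianTilde D ((labels n).map fun p => (s.chi D p.1 p.2, s.S p.1 p.2 j l)) (s.chiStar D j l)

end CKP

end

noncomputable section

namespace CKP

/-! The argument lives in the variable `x` alone. The `t_r`-flow of a potential is Res(D⁻¹ g L f
D⁻¹), since the negative part of `L` is of too low order to contribute. Equating it with the
normalization removes the time derivative and leaves the bilinear identity S(L f, g) - S(f, L^* g) -
∑_b S(f, Ψ_b) S(Φ_b, g) = Res(D⁻¹ g L f D⁻¹). The `t_1`-flow gives ∂S(f, g) = f g. These two
relations and the Lax form constitute `IsStatic`.

Every single step preserves `IsStatic` (`isStatic_db`, `isStatic_adb`). The actions of L₊ and L₊^*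
are residues of products, so in the associative ring `Psi D` a conjugation by T = φ D φ⁻¹ reduces to
two rules: T⁻¹ T(f) D⁻¹ = f D⁻¹ - φ D⁻¹ (f/φ), and D⁻¹ g' T = D⁻¹ g - S(φ, g)/φ for g' = -S(φ, g)/φ.
They show that a DB step sends χ_i^{(k)} to T(χ_i^{(k)}) and χ_j^{*(l)} to -S(Φ_a, χ_j^{*(l)})/Φ_a,
with labels shifted at the index `a` only. The bilinear identity is what makes the second family
stable under the new L^*. The adjoint step is the mirror image.

The determinants obey the same recursion: W[φ, f, …] = φ W[T(f), …], and W̃ likewise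
(`wronskian_cons`, `wronskianTilde_cons`). Hence the product of the pivots of the DB steps is W_n,
and afterwards χ_s^{*(l)} has become -Δ_{(l,s)}/W_n (`run_db`). The adjoint steps multiply τ by the
Wronskian of these functions (`run_adb`); taking the common factor -1/W_n out of its ∑ k_j columns
gives the formula. -/

theorem finsum_eq_finsum_comp_of_injective {α β M : Type*} [AddCommMonoid M] {e : β → α}
    (he : Function.Injective e) {f : α → M} (hf : ∀ x, x ∉ Set.range e → f x = 0) :
    ∑ᶠ x, f x = ∑ᶠ y, f (e y) := by
  classical
  rw [← finsum_mem_range he]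
  refine finsum_congr fun x => ?_
  by_cases h : x ∈ Set.range e
  · rw [finsum_eq_if, if_pos h]
  · rw [finsum_eq_if, if_neg h, hf x h]

/-- On the support i ≤ N and k ≤ K + i, while k ≥ 0, so (i, k) ranges over a finite triangle. The
two bounds come from the orders of the two factors of a product. -/
theorem finite_support_of_bounds {M : Type*} [Zero M] {f : ℤ × ℕ → M} (N K : ℤ)
    (h₁ : ∀ p : ℤ × ℕ, N < p.1 → f p = 0) (h₂ : ∀ p : ℤ × ℕ, K < -p.1 + p.2 → f p = 0) :
    (Function.support f).Finite := by
  refine (((Finset.Icc (-K) N) ×ˢ (Finset.range ((K + N).toNat + 1))).finite_toSet).subset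
    fun p hp => ?_
  have h1 : ¬ N < p.1 := fun h => hp (h₁ p h)
  have h2 : ¬ K < -p.1 + p.2 := fun h => hp (h₂ p h)
  simp only [Finset.coe_product, Set.mem_prod, Finset.mem_coe, Finset.mem_Icc, Finset.mem_range]
  omega

variable {R : Type*} [CommRing R] [Algebra ℚ R]

/-! ### The ring of formal pseudo-differential operators -/

/-- Pseudo-differential operators with the product given by the derivation `D`. -/
def Psi (_D : Derivation ℚ R R) : Type _ := PDO R

namespace Psi

variable {D : Derivation ℚ R R}

/-- The coefficient of `D^n`. -/
def coeff (A : Psi D) (n : ℤ) : R := PDO.coeff A n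

theorem bounded (A : Psi D) : ∃ N : ℤ, ∀ n, N < n → A.coeff n = 0 := PDO.bounded A

@[ext]
theorem ext {A B : Psi D} (h : ∀ n, A.coeff n = B.coeff n) : A = B :=
  PDO.ext (funext h)

instance : Zero (Psi D) := ⟨(⟨fun _ => 0, ⟨0, fun _ _ => rfl⟩⟩ : PDO R)⟩

instance : One (Psi D) := ⟨PDO.mono 0 1⟩

instance : Add (Psi D) := ⟨fun A B => (⟨fun n => A.coeff n + B.coeff n, by
  obtain ⟨N, hN⟩ := A.bounded
  obtain ⟨M, hM⟩ := B.bounded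
  exact ⟨max N M, fun n hn => by rw [hN n (by omega), hM n (by omega), add_zero]⟩⟩ : PDO R)⟩

instance : Neg (Psi D) := ⟨fun A => (⟨fun n => -A.coeff n, by
  obtain ⟨N, hN⟩ := A.bounded
  exact ⟨N, fun n hn => by rw [hN n hn, neg_zero]⟩⟩ : PDO R)⟩

instance : Mul (Psi D) := ⟨fun A B => PDO.mul D A B⟩

@[simp] theorem coeff_zero (n : ℤ) : (0 : Psi D).coeff n = 0 := rfl

@[simp] theorem coeff_add (A B : Psi D) (n : ℤ) : (A + B).coeff n = A.coeff n + B.coeff n := rfl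

@[simp] theorem coeff_neg (A : Psi D) (n : ℤ) : (-A).coeff n = -A.coeff n := rfl

instance : AddCommGroup (Psi D) where
  add_assoc A B C := ext fun n => by simp [add_assoc]
  zero_add A := ext fun n => by simp
  add_zero A := ext fun n => by simp
  add_comm A B := ext fun n => by simp [add_comm]
  neg_add_cancel A := ext fun n => by simp
  nsmul := nsmulRec
  zsmul := zsmulRec

@[simp] theorem coeff_sub (A B : Psi D) (n : ℤ) : (A - B).coeff n = A.coeff n - B.coeff n := by
  rw [sub_eq_add_neg, coeff_add, coeff_neg, sub_eq_add_neg]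

/-- Taking a coefficient, as an additive map. -/
def coeffHom (n : ℤ) : Psi D →+ R where
  toFun A := A.coeff n
  map_zero' := rfl
  map_add' _ _ := rfl

@[simp] theorem coeff_sum {ι : Type*} (s : Finset ι) (A : ι → Psi D) (n : ℤ) :
    (∑ i ∈ s, A i).coeff n = ∑ i ∈ s, (A i).coeff n :=
  map_sum (coeffHom n) A s

/-- The terms of the sum defining a coefficient of a product. -/
def mulTerm (A B : Psi D) (n : ℤ) (p : ℤ × ℕ) : R :=
  (Ring.choose p.1 p.2 : ℤ) • (A.coeff p.1 * D^[p.2] (B.coeff (n - p.1 + p.2)))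

theorem coeff_mul (A B : Psi D) (n : ℤ) : (A * B).coeff n = ∑ᶠ p, mulTerm A B n p := rfl

theorem mulTerm_eq_zero_left {A B : Psi D} {n : ℤ} {p : ℤ × ℕ} (h : A.coeff p.1 = 0) :
    mulTerm A B n p = 0 := by
  rw [mulTerm, h, zero_mul, smul_zero]

theorem mulTerm_eq_zero_right {A B : Psi D} {n : ℤ} {p : ℤ × ℕ}
    (h : B.coeff (n - p.1 + p.2) = 0) : mulTerm A B n p = 0 := by
  rw [mulTerm, h, iterate_map_zero, mul_zero, smul_zero]

theorem mulTerm_finite (A B : Psi D) (n : ℤ) : (Function.support (mulTerm A B n)).Finite := by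
  obtain ⟨N, hN⟩ := A.bounded
  obtain ⟨M, hM⟩ := B.bounded
  exact finite_support_of_bounds N (M - n) (fun p hp => mulTerm_eq_zero_left (hN _ hp))
    (fun p hp => mulTerm_eq_zero_right (hM _ (by omega)))

theorem iterate_add (k : ℕ) (f g : R) : D^[k] (f + g) = D^[k] f + D^[k] g :=
  iterate_map_add D k f g

instance nonUnitalNonAssocRing : NonUnitalNonAssocRing (Psi D) where
  left_distrib A B C := ext fun n => by
    rw [coeff_add, coeff_mul, coeff_mul, coeff_mul,
      ← finsum_add_distrib (mulTerm_finite A B n) (mulTerm_finite A C n)]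
    refine finsum_congr fun p => ?_
    simp only [mulTerm, coeff_add, iterate_add, mul_add, smul_add]
  right_distrib A B C := ext fun n => by
    rw [coeff_add, coeff_mul, coeff_mul, coeff_mul,
      ← finsum_add_distrib (mulTerm_finite A C n) (mulTerm_finite B C n)]
    refine finsum_congr fun p => ?_
    simp only [mulTerm, coeff_add, add_mul, smul_add]
  zero_mul A := ext fun n => by
    rw [coeff_mul, coeff_zero]
    exact finsum_eq_zero_of_forall_eq_zero fun p => mulTerm_eq_zero_left rfl
  mul_zero A := ext fun n => by
    rw [coeff_mul, coeff_zero]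
    exact finsum_eq_zero_of_forall_eq_zero fun p => mulTerm_eq_zero_right rfl

/-- `f D^n`. -/
def mono (D : Derivation ℚ R R) (n : ℤ) (f : R) : Psi D := PDO.mono n f

theorem coeff_mono (n : ℤ) (f : R) (k : ℤ) :
    (mono D n f).coeff k = if k = n then f else 0 := rfl

theorem coeff_mono_mul (i : ℤ) (a : R) (B : Psi D) (n : ℤ) :
    (mono D i a * B).coeff n =
      ∑ᶠ k : ℕ, (Ring.choose i k : ℤ) • (a * D^[k] (B.coeff (n - i + k))) := by
  rw [coeff_mul, finsum_eq_finsum_comp_of_injective (e := fun k : ℕ => (i, k))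
    (fun a b h => by simpa using h)]
  · exact finsum_congr fun k => by simp [mulTerm, coeff_mono]
  · rintro ⟨i', k⟩ h
    refine mulTerm_eq_zero_left ?_
    rw [coeff_mono, if_neg]
    rintro rfl
    exact h ⟨k, rfl⟩

theorem coeff_mul_mono (A : Psi D) (j : ℤ) (b : R) (n : ℤ) :
    (A * mono D j b).coeff n =
      ∑ᶠ k : ℕ, (Ring.choose (n - j + k) k : ℤ) • (A.coeff (n - j + k) * D^[k] b) := by
  rw [coeff_mul, finsum_eq_finsum_comp_of_injective (e := fun k : ℕ => (n - j + k, k))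
    (fun a b h => (Prod.mk.inj h).2)]
  · refine finsum_congr fun k => ?_
    rw [mulTerm, coeff_mono, if_pos (by ring)]
  · rintro ⟨i, k⟩ h
    refine mulTerm_eq_zero_right ?_
    rw [coeff_mono, if_neg]
    intro h'
    exact h ⟨k, Prod.ext (by simp only at h' ⊢; omega) rfl⟩

/-- Multiplication by a function. -/
def C (D : Derivation ℚ R R) (f : R) : Psi D := mono D 0 f

/-- The operator `D`. -/
def X (D : Derivation ℚ R R) : Psi D := mono D 1 1

/-- The operator `D⁻¹`. -/
def Xi (D : Derivation ℚ R R) : Psi D := mono D (-1) 1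

theorem coeff_C (f : R) (k : ℤ) : (C D f).coeff k = if k = 0 then f else 0 := rfl

@[simp] theorem coeff_C_mul (f : R) (A : Psi D) (n : ℤ) : (C D f * A).coeff n = f * A.coeff n := by
  rw [C, coeff_mono_mul, finsum_eq_single _ 0]
  · simp
  · intro k hk
    rw [Ring.choose_zero_pos ℤ (Nat.pos_of_ne_zero hk), zero_smul]

theorem coeff_X_mul (A : Psi D) (n : ℤ) :
    (X D * A).coeff n = A.coeff (n - 1) + D (A.coeff n) := by
  rw [X, coeff_mono_mul, finsum_eq_sum_of_support_subset (s := Finset.range 2)]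
  · simp [Finset.sum_range_succ]
  · intro k hk
    by_contra h
    refine hk ?_
    have h2 : 1 < k := by simpa using h
    have : Ring.choose (1 : ℤ) k = 0 := by
      have := Ring.choose_natCast (R := ℤ) 1 k
      rw [Nat.choose_eq_zero_of_lt h2] at this
      simpa using this
    simp [this]

theorem iterate_one {k : ℕ} (hk : k ≠ 0) : D^[k] (1 : R) = 0 := by
  obtain ⟨k, rfl⟩ := Nat.exists_eq_succ_of_ne_zero hk
  rw [Function.iterate_succ_apply, D.map_one_eq_zero, iterate_map_zero]

theorem coeff_mul_mono_one (A : Psi D) (j n : ℤ) :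
    (A * mono D j 1).coeff n = A.coeff (n - j) := by
  rw [coeff_mul_mono, finsum_eq_single _ 0]
  · simp
  · intro k hk
    rw [iterate_one hk, mul_zero, smul_zero]

theorem coeff_mul_X (A : Psi D) (n : ℤ) : (A * X D).coeff n = A.coeff (n - 1) :=
  coeff_mul_mono_one A 1 n

theorem coeff_mul_Xi (A : Psi D) (n : ℤ) : (A * Xi D).coeff n = A.coeff (n + 1) := by
  rw [Xi, coeff_mul_mono_one, sub_neg_eq_add]

theorem mono_eq_C_mul (n : ℤ) (f : R) : mono D n f = C D f * mono D n 1 := by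
  ext k
  rw [coeff_C_mul, coeff_mono, coeff_mono, mul_ite, mul_one, mul_zero]

theorem X_mul_Xi : X D * Xi D = C D 1 := by
  ext n
  simp only [coeff_mul_Xi, X, coeff_mono, coeff_C]
  congr 1
  exact propext (by omega)

/-! ### Associativity -/

/-- Left multiplication by `A` is associative. -/
def LAssoc (A : Psi D) : Prop := ∀ B E : Psi D, (A * B) * E = A * (B * E)

theorem lassoc_C (f : R) : LAssoc (C D f) := fun B E => by
  ext n
  rw [coeff_C_mul, coeff_mul, coeff_mul, mul_finsum' _ _ (mulTerm_finite B E n)]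
  refine finsum_congr fun p => ?_
  rw [mulTerm, mulTerm, coeff_C_mul, mul_smul_comm, mul_assoc]

theorem LAssoc.mul {A B : Psi D} (hA : LAssoc A) (hB : LAssoc B) : LAssoc (A * B) := fun E F => by
  rw [hA, hA, hB, hA]

theorem LAssoc.add {A B : Psi D} (hA : LAssoc A) (hB : LAssoc B) : LAssoc (A + B) := fun E F => by
  rw [add_mul, add_mul, add_mul, hA, hB]

theorem derivation_finsum {f : ℤ × ℕ → R} (hf : (Function.support f).Finite) :
    D (∑ᶠ p, f p) = ∑ᶠ p, D (f p) :=
  (D : R →+ R).map_finsum hf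

/-- This is the Leibniz rule for ∂ on the terms a_i ∂^k b combined with Pascal's rule for the
generalized binomial coefficients. -/
theorem lassoc_X : LAssoc (X D) := fun A B => by
  ext n
  rw [coeff_X_mul]
  obtain ⟨N, hN⟩ := A.bounded
  obtain ⟨M, hM⟩ := B.bounded
  let G : ℤ × ℕ → R := fun p =>
    (Ring.choose p.1 p.2 : ℤ) • (A.coeff p.1 * D^[p.2 + 1] (B.coeff (n - p.1 + p.2)))
  let H : ℤ × ℕ → R := fun p =>
    (Ring.choose p.1 p.2 : ℤ) • (D (A.coeff p.1) * D^[p.2] (B.coeff (n - p.1 + p.2)))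
  -- `G` and `H` are the terms of ∂((AB)_n) in which ∂ hits the coefficient of `B`, respectively of
  -- `A`. `K` comes from the shifted part A_{i-1} of the coefficients of D A. Pascal's rule splits
  -- `K` into (AB)_{n-1} and `G'`, which is `G` with `k` moved up by one.
  let G' : ℤ × ℕ → R := fun p => if p.2 = 0 then 0 else G (p.1, p.2 - 1)
  let K : ℤ × ℕ → R := fun p =>
    (Ring.choose p.1 p.2 : ℤ) • (A.coeff (p.1 - 1) * D^[p.2] (B.coeff (n - p.1 + p.2)))
  have hG : (Function.support G).Finite :=
    finite_support_of_bounds N (M - n) (fun p hp => by simp [G, hN _ hp])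
      (fun p hp => by simp only [G]; rw [hM _ (by omega)]; simp)
  have hH : (Function.support H).Finite :=
    finite_support_of_bounds N (M - n) (fun p hp => by simp [H, hN _ hp])
      (fun p hp => by simp only [H]; rw [hM _ (by omega)]; simp)
  have hK : (Function.support K).Finite :=
    finite_support_of_bounds (N + 1) (M - n)
      (fun p hp => by simp only [K]; rw [hN _ (by omega)]; simp)
      (fun p hp => by simp only [K]; rw [hM _ (by omega)]; simp)
  have hG' : (Function.support G').Finite :=
    finite_support_of_bounds N (M - n + 1)
      (fun p hp => by
        simp only [G', G]
        split_ifs with h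
        · rfl
        · rw [hN _ hp]; simp)
      (fun p hp => by
        simp only [G', G]
        split_ifs with h
        · rfl
        · rw [hM _ (by omega)]; simp)
  have e1 : ∑ᶠ p, G' p = ∑ᶠ p, G p := by
    rw [finsum_eq_finsum_comp_of_injective (e := fun p : ℤ × ℕ => (p.1, p.2 + 1))]
    · exact finsum_congr fun p => by simp [G']
    · rintro ⟨a, b⟩ ⟨c, e⟩ h
      simpa using h
    · rintro ⟨i, k⟩ h
      cases k with
      | zero => simp [G']
      | succ k => exact absurd ⟨(i, k), rfl⟩ h
  have e2 : ∑ᶠ p, K p = (A * B).coeff (n - 1) + ∑ᶠ p, G' p := by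
    rw [coeff_mul, ← finsum_add_distrib (mulTerm_finite A B _) hG',
      finsum_eq_finsum_comp_of_injective (e := fun p : ℤ × ℕ => (p.1 + 1, p.2))]
    · refine finsum_congr fun p => ?_
      obtain ⟨i, k⟩ := p
      cases k with
      | zero => simp [K, G', mulTerm, show n - (i + 1) = n - 1 - i by ring]
      | succ k =>
        have h1 : n - 1 - i + ((k + 1 : ℕ) : ℤ) = n - i + k := by push_cast; ring
        have h2 : n - (i + 1) + ((k + 1 : ℕ) : ℤ) = n - i + k := by push_cast; ring
        simp only [K, G', G, mulTerm, h1, h2, Ring.choose_succ_succ, add_sub_cancel_right,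
          add_smul, Nat.add_sub_cancel, if_neg (Nat.succ_ne_zero k)]
        rw [add_comm]
    · rintro ⟨a, b⟩ ⟨c, e⟩ h
      simpa using h
    · rintro ⟨i, k⟩ h
      exact absurd ⟨(i - 1, k), by simp⟩ h
  have e3 : D ((A * B).coeff n) = ∑ᶠ p, H p + ∑ᶠ p, G p := by
    rw [coeff_mul, derivation_finsum (mulTerm_finite A B n), ← finsum_add_distrib hH hG]
    refine finsum_congr fun p => ?_
    simp only [mulTerm, H, G, D.map_smul_of_tower, D.leibniz, smul_eq_mul, ← smul_add]
    rw [Function.iterate_succ_apply']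
    ring_nf
  rw [e3, add_left_comm, ← e1, ← e2, coeff_mul, ← finsum_add_distrib hH hK]
  refine finsum_congr fun p => ?_
  simp only [mulTerm, H, K, coeff_X_mul, add_mul, smul_add]
  rw [add_comm]

/-- If D E = 0 then E_{n-1} = -∂E_n, so the vanishing of `E` above its order propagates downwards to
all coefficients. -/
theorem X_mul_injective {A B : Psi D} (h : X D * A = X D * B) : A = B := by
  have h0 : ∀ n, (A - B).coeff (n - 1) = -D ((A - B).coeff n) := fun n => by
    have := congrArg (fun E => E.coeff n) h
    simp only [coeff_X_mul] at this
    rw [coeff_sub, coeff_sub, map_sub]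
    linear_combination this
  obtain ⟨N, hN⟩ := (A - B).bounded
  have h1 : ∀ k : ℕ, (A - B).coeff (N + 1 - k) = 0 := fun k => by
    induction k with
    | zero => exact hN _ (by simp)
    | succ k ih =>
      have := h0 (N + 1 - k)
      rw [ih, map_zero, neg_zero] at this
      rw [← this]
      congr 1
      push_cast
      ring
  rw [← sub_eq_zero]
  ext n
  rw [coeff_zero]
  by_cases hn : N < n
  · exact hN n hn
  · have := h1 (N + 1 - n).toNat
    rwa [Int.toNat_of_nonneg (by omega), sub_sub_cancel] at this

theorem C_one_mul (A : Psi D) : C D 1 * A = A := by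
  ext n
  rw [coeff_C_mul, one_mul]

/-- Left multiplication by `D` is injective and already associates, so D⁻¹ can be cancelled against
it without expanding its infinite Leibniz series. -/
theorem lassoc_Xi : LAssoc (Xi D) := fun A B => by
  apply X_mul_injective
  rw [← lassoc_X, ← lassoc_X, ← lassoc_X, X_mul_Xi, C_one_mul, C_one_mul]

theorem Xi_mul_X : Xi D * X D = C D 1 := by
  apply X_mul_injective
  rw [← lassoc_X, X_mul_Xi]
  ext n
  rw [coeff_C_mul, one_mul, C, coeff_mul_mono_one, sub_zero]

theorem mono_one_mul_X (n : ℤ) : mono D n 1 * X D = mono D (n + 1) 1 := by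
  ext k
  rw [coeff_mul_X, coeff_mono, coeff_mono]
  congr 1
  exact propext (by omega)

theorem mono_one_mul_Xi (n : ℤ) : mono D n 1 * Xi D = mono D (n - 1) 1 := by
  ext k
  rw [coeff_mul_Xi, coeff_mono, coeff_mono]
  congr 1
  exact propext (by omega)

theorem lassoc_mono (n : ℤ) (f : R) : LAssoc (mono D n f) := by
  rw [mono_eq_C_mul]
  refine (lassoc_C f).mul ?_
  induction n with
  | zero => exact lassoc_C 1
  | succ n ih => rw [← mono_one_mul_X]; exact ih.mul lassoc_X
  | pred n ih => rw [← mono_one_mul_Xi]; exact ih.mul lassoc_Xi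

/-- `A` has order at most `N`. -/
def OrdLe (A : Psi D) (N : ℤ) : Prop := ∀ n, N < n → A.coeff n = 0

theorem OrdLe.mono {A : Psi D} {N M : ℤ} (hA : OrdLe A N) (h : N ≤ M) : OrdLe A M :=
  fun n hn => hA n (by omega)

theorem OrdLe.mul {A B : Psi D} {N M : ℤ} (hA : OrdLe A N) (hB : OrdLe B M) :
    OrdLe (A * B) (N + M) := fun n hn => by
  rw [coeff_mul]
  refine finsum_eq_zero_of_forall_eq_zero fun p => ?_
  by_cases h : N < p.1
  · exact mulTerm_eq_zero_left (hA _ h)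
  · exact mulTerm_eq_zero_right (hB _ (by omega))

theorem lassoc_sum {ι : Type*} (s : Finset ι) (A : ι → Psi D) (h : ∀ i ∈ s, LAssoc (A i)) :
    LAssoc (∑ i ∈ s, A i) := fun B E => by
  rw [Finset.sum_mul, Finset.sum_mul, Finset.sum_mul]
  exact Finset.sum_congr rfl fun i hi => h i hi B E

theorem lassoc (A : Psi D) : LAssoc A := fun B E => by
  ext n
  obtain ⟨N, hN⟩ := A.bounded
  obtain ⟨M, hM⟩ := B.bounded
  obtain ⟨K, hK⟩ := E.bounded
  -- A fixed coefficient of a triple product sees only finitely many terms of `A`: those of degree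
  -- below n - M - K cannot reach D^n. The truncation `P` is a finite sum of monomials, for which
  -- associativity is known.
  let P : Psi D := ∑ i ∈ Finset.Icc (n - M - K) N, mono D i (A.coeff i)
  have hP : LAssoc P := lassoc_sum _ _ fun i _ => lassoc_mono i _
  have hA : OrdLe (A - P) (n - M - K - 1) := fun k hk => by
    simp only [P, coeff_sub, coeff_sum, coeff_mono]
    rw [Finset.sum_ite_eq]
    split_ifs with h
    · rw [sub_self]
    · rw [sub_zero]
      rw [Finset.mem_Icc] at h
      exact hN k (by omega)
  have hBE : OrdLe (B * E) (M + K) := OrdLe.mul hM hK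
  have h1 : (((A - P) * B) * E).coeff n = 0 := ((hA.mul hM).mul hK) n (by omega)
  have h2 : ((A - P) * (B * E)).coeff n = 0 := (hA.mul hBE) n (by omega)
  rw [sub_mul, coeff_sub] at h2
  rw [sub_mul, sub_mul, coeff_sub, hP B E] at h1
  exact (sub_eq_zero.1 h1).trans (sub_eq_zero.1 h2).symm

instance : Ring (Psi D) where
  __ := nonUnitalNonAssocRing (D := D)
  mul_assoc := lassoc
  one_mul A := C_one_mul A
  mul_one A := by
    ext n
    exact (coeff_mul_mono_one A 0 n).trans (by rw [sub_zero])

end Psi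

namespace Psi

variable {D : Derivation ℚ R R}

/-! ### Calculus with `D`, `D⁻¹` and functions -/

theorem C_mul (f g : R) : C D (f * g) = C D f * C D g := by
  ext n
  simp [coeff_C]

theorem C_add (f g : R) : C D (f + g) = C D f + C D g := by
  ext n
  simp only [coeff_C, coeff_add]
  split_ifs <;> simp

theorem C_neg (f : R) : C D (-f) = -C D f := by
  ext n
  simp only [coeff_C, coeff_neg]
  split_ifs <;> simp

theorem C_sub (f g : R) : C D (f - g) = C D f - C D g := by
  rw [sub_eq_add_neg, C_add, C_neg, sub_eq_add_neg]

@[simp] theorem C_one : C D (1 : R) = 1 := rfl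

theorem C_comm (f g : R) : C D f * C D g = C D g * C D f := by
  rw [← C_mul, mul_comm, C_mul]

theorem X_mul_C (f : R) : X D * C D f = C D f * X D + C D (D f) := by
  ext n
  rw [coeff_X_mul, coeff_add, coeff_C_mul, coeff_C, coeff_C, coeff_C, X, coeff_mono]
  have : n - 1 = 0 ↔ n = 1 := by omega
  simp only [this]
  split_ifs <;> simp

theorem C_D (f : R) : C D (D f) = X D * C D f - C D f * X D := by
  rw [X_mul_C, add_sub_cancel_left]

@[simp] theorem X_Xi : X D * Xi D = 1 := X_mul_Xi

@[simp] theorem Xi_X : Xi D * X D = 1 := Xi_mul_X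

@[simp] theorem X_Xi_assoc (A : Psi D) : X D * (Xi D * A) = A := by
  rw [← mul_assoc, X_Xi, one_mul]

@[simp] theorem Xi_X_assoc (A : Psi D) : Xi D * (X D * A) = A := by
  rw [← mul_assoc, Xi_X, one_mul]

/-- Integration by parts, from ∂s = D s - s D. It turns a primitive such as a squared eigenfunction
potential into a splitting of D⁻¹ (f g) D⁻¹. -/
theorem Xi_C_D_Xi (s : R) : Xi D * C D (D s) * Xi D = C D s * Xi D - Xi D * C D s := by
  rw [C_D, mul_sub, sub_mul, Xi_X_assoc, mul_assoc, mul_assoc, X_Xi, mul_one]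

theorem Xi_C_X (s : R) : Xi D * C D s * X D = C D s - Xi D * C D (D s) := by
  rw [C_D, mul_sub, Xi_X_assoc, sub_sub_cancel, mul_assoc]

theorem X_C_Xi (s : R) : X D * C D s * Xi D = C D s + C D (D s) * Xi D := by
  rw [X_mul_C, add_mul, mul_assoc, X_Xi, mul_one]

theorem choose_eq_zero {i : ℤ} {k : ℕ} (h0 : 0 ≤ i) (h : i < k) : Ring.choose i k = 0 := by
  obtain ⟨j, rfl⟩ := Int.eq_ofNat_of_zero_le h0
  have := Ring.choose_natCast (R := ℤ) j k
  rw [Nat.choose_eq_zero_of_lt (by omega)] at this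
  simpa using this

/-- The corrections carry the binomials (k-1 choose k), which vanish for k ≥ 1. Functions can
therefore be pulled out of a residue on the right. -/
theorem res_mul_C (A : Psi D) (h : R) : (A * C D h).coeff (-1) = A.coeff (-1) * h := by
  rw [C, coeff_mul_mono, finsum_eq_single _ 0]
  · simp
  · intro k hk
    rw [choose_eq_zero (by omega) (by omega), zero_smul]

theorem coeff_mul_C_of_ordLe {A : Psi D} {N : ℤ} (hA : OrdLe A N) (h : R) :
    (A * C D h).coeff N = A.coeff N * h := by
  rw [C, coeff_mul_mono, finsum_eq_single _ 0]
  · simp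
  · intro k hk
    rw [hA _ (by omega), zero_mul, smul_zero]

theorem ordLe_C (f : R) : OrdLe (C D f) 0 := fun n hn => by rw [coeff_C, if_neg (by omega)]

theorem ordLe_X : OrdLe (X D) 1 := fun n hn => by rw [X, coeff_mono, if_neg (by omega)]

theorem ordLe_Xi : OrdLe (Xi D) (-1) := fun n hn => by rw [Xi, coeff_mono, if_neg (by omega)]

/-- `A` has no negative powers of `D`. -/
def IsDiff (A : Psi D) : Prop := ∀ n, n < 0 → A.coeff n = 0

theorem IsDiff.add {A B : Psi D} (hA : IsDiff A) (hB : IsDiff B) : IsDiff (A + B) :=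
  fun n hn => by rw [coeff_add, hA n hn, hB n hn, add_zero]

theorem IsDiff.neg {A : Psi D} (hA : IsDiff A) : IsDiff (-A) :=
  fun n hn => by rw [coeff_neg, hA n hn, neg_zero]

theorem IsDiff.mul {A B : Psi D} (hA : IsDiff A) (hB : IsDiff B) : IsDiff (A * B) :=
  fun n hn => by
    rw [coeff_mul]
    refine finsum_eq_zero_of_forall_eq_zero fun p => ?_
    by_cases h1 : p.1 < 0
    · exact mulTerm_eq_zero_left (hA _ h1)
    by_cases h2 : n - p.1 + p.2 < 0
    · exact mulTerm_eq_zero_right (hB _ h2)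
    rw [mulTerm, choose_eq_zero (by omega) (by omega), zero_smul]

theorem isDiff_C (f : R) : IsDiff (C D f) := fun n hn => by rw [coeff_C, if_neg (by omega)]

theorem isDiff_X : IsDiff (X D) := fun n hn => by rw [X, coeff_mono, if_neg (by omega)]

/-! ### Actions on functions as residues -/

/-- A pseudo-differential operator as an element of the ring defined by `D`. -/
def ofPDO (D : Derivation ℚ R R) (A : PDO R) : Psi D := A

theorem coeff_ofPDO (A : PDO R) (n : ℤ) : (ofPDO D A).coeff n = A.coeff n := rfl

theorem act_eq_coeff (A : PDO R) (f : R) : A.act D f = (ofPDO D A * C D f).coeff 0 := by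
  rw [C, coeff_mul_mono]
  refine finsum_congr fun k => ?_
  have : ((0 : ℤ) - 0 + k) = ((k : ℕ) : ℤ) := by ring
  rw [this, Ring.choose_natCast, Nat.choose_self, Nat.cast_one, one_smul]
  rfl

/-- Writing an action as a residue lets conjugated operators be evaluated by ring manipulations; the
adjoint action is treated likewise with D⁻¹ g on the left. -/
theorem act_eq_res (A : PDO R) (f : R) : A.act D f = (ofPDO D A * C D f * Xi D).coeff (-1) := by
  rw [coeff_mul_Xi, act_eq_coeff]
  rfl

theorem choose_neg_one (k : ℕ) : Ring.choose (-1 : ℤ) k = (-1) ^ k := by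
  rw [Ring.choose_neg]
  have : Ring.choose ((1 : ℤ) + k - 1) k = 1 := by
    rw [add_sub_cancel_left, Ring.choose_natCast, Nat.choose_self, Nat.cast_one]
  rw [this, Int.negOnePow_def]
  simp [Units.smul_def]

theorem actAdj_eq_res (A : PDO R) (g : R) :
    A.actAdj D g = (Xi D * C D g * ofPDO D A).coeff (-1) := by
  rw [mul_assoc, Xi, coeff_mono_mul]
  refine finsum_congr fun k => ?_
  have : ((-1 : ℤ) - -1 + k) = ((k : ℕ) : ℤ) := by ring
  rw [this, choose_neg_one, coeff_C_mul, coeff_ofPDO, one_mul, mul_comm g, zsmul_eq_mul]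
  push_cast
  rfl

/-- The product has order at most -3. Hence L₊ may be replaced by `L` in the flux of a potential. -/
theorem res_flux_eq_zero {A : Psi D} (hA : OrdLe A (-1)) (f g : R) :
    (Xi D * C D g * A * C D f * Xi D).coeff (-1) = 0 :=
  ((((ordLe_Xi.mul (ordLe_C g)).mul hA).mul (ordLe_C f)).mul ordLe_Xi) _ (by norm_num)

theorem sepFlux_plus_eq_res (A : PDO R) (f g : R) :
    sepFlux D A.plus f g = (Xi D * C D g * ofPDO D A * C D f * Xi D).coeff (-1) := by
  have h : OrdLe (ofPDO D A - ofPDO D A.plus) (-1) := fun n hn => by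
    rw [coeff_sub, coeff_ofPDO, coeff_ofPDO, sub_eq_zero]
    exact (if_pos (by omega)).symm
  have := res_flux_eq_zero h f g
  rw [mul_sub, sub_mul, sub_mul, coeff_sub, sub_eq_zero] at this
  exact this.symm

theorem act_plus (A : PDO R) (f : R) : A.plus.act D f = A.act D f :=
  finsum_congr fun k => by simp [PDO.plus]

theorem actAdj_plus (A : PDO R) (f : R) : A.plus.actAdj D f = A.actAdj D f :=
  finsum_congr fun k => by simp [PDO.plus]

theorem isDiff_plus (A : PDO R) : IsDiff (ofPDO D A.plus) := fun n hn =>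
  if_neg (by omega)

theorem ofPDO_mul (A B : PDO R) : ofPDO D (PDO.mul D A B) = ofPDO D A * ofPDO D B := rfl

theorem ofPDO_mono_zero (f : R) : ofPDO D (PDO.mono 0 f) = C D f := rfl

theorem ofPDO_mono_one (f : R) : ofPDO D (PDO.mono 1 f) = C D f * X D := mono_eq_C_mul 1 f

theorem ofPDO_mono_neg_one (f : R) : ofPDO D (PDO.mono (-1) f) = C D f * Xi D :=
  mono_eq_C_mul (-1) f

theorem C_X_C (u v : R) : C D u * X D * C D v = C D (u * v) * X D + C D (u * D v) := by
  rw [mul_assoc, X_mul_C, mul_add, ← mul_assoc, ← C_mul, ← C_mul]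

/-! ### Conjugation by `φ D φ⁻¹` -/

section Gauge

variable {φ φi : R}

theorem C_mul_C_inv (h : φ * φi = 1) : C D φ * C D φi = 1 := by rw [← C_mul, h, C_one]

theorem C_mul_C_inv_assoc (h : φ * φi = 1) (A : Psi D) : C D φ * (C D φi * A) = A := by
  rw [← mul_assoc, C_mul_C_inv h, one_mul]

/-- `T⁻¹ T(f) D⁻¹ = f D⁻¹ - φ D⁻¹ (f/φ)` for `T = φ D φ⁻¹`. -/
theorem gaugeInv_mul_C_gauge (h : φ * φi = 1) (f : R) :
    C D φ * Xi D * C D φi * C D (φ * D (φi * f)) * Xi D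
      = C D f * Xi D - C D φ * Xi D * C D (φi * f) := by
  have h' : φi * φ = 1 := by rw [mul_comm, h]
  rw [C_mul, mul_assoc _ (C D φi), C_mul_C_inv_assoc h', mul_assoc, mul_assoc, ← mul_assoc (Xi D),
    Xi_C_D_Xi, mul_sub, C_mul, ← mul_assoc, C_mul_C_inv_assoc h]
  noncomm_ring

/-- `D⁻¹ g' T = D⁻¹ g - σ/φ` for `T = φ D φ⁻¹` and `g' = -σ/φ`, `∂σ = φ g`. -/
theorem Xi_mul_C_mul_gauge (h : φ * φi = 1) {σ g : R} (hσ : D σ = φ * g) :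
    Xi D * C D (-(φi * σ)) * (C D φ * X D * C D φi) = Xi D * C D g - C D (φi * σ) := by
  have e : Xi D * C D (-(φi * σ)) * (C D φ * X D * C D φi)
      = Xi D * C D (-(φi * σ) * φ) * X D * C D φi := by
    rw [C_mul _ φ]; simp only [mul_assoc]
  have e1 : -(φi * σ) * φ = -σ := by linear_combination -σ * h
  have e2 : -(φ * g) * φi = -g := by linear_combination -g * h
  rw [e, e1, Xi_C_X, map_neg, hσ, sub_mul, mul_assoc, ← C_mul, ← C_mul, e2, C_neg, neg_mul, C_neg,
    mul_comm σ]
  noncomm_ring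

theorem Xi_mul_C_inv_mul_gauge (h : φ * φi = 1) :
    Xi D * C D φi * (C D φ * X D * C D φi) = C D φi := by
  have h' : φi * φ = 1 := by rw [mul_comm, h]
  rw [mul_assoc (C D φ), mul_assoc, C_mul_C_inv_assoc h', Xi_X_assoc]

theorem res_gauge_mul (h : φ * φi = 1) (A : Psi D) :
    (C D φ * X D * C D φi * A * Xi D).coeff (-1) = A.coeff (-1) + φ * D (φi * A.coeff 0) := by
  rw [coeff_mul_Xi, mul_assoc, mul_assoc, coeff_C_mul, coeff_X_mul, coeff_C_mul, coeff_C_mul]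
  norm_num
  linear_combination A.coeff (-1) * h

/-- The action of `(T L T⁻¹)₊` on `T(f)`, where `T = φ D φ⁻¹`. -/
theorem act_gauge_conj (h : φ * φi = 1) (L : Psi D) (f : R) :
    ((C D φ * X D * C D φi) * L * (C D φ * Xi D * C D φi) * C D (φ * D (φi * f)) * Xi D).coeff (-1)
      = φ * D (φi * (L * C D f).coeff 0)
        - φ * D (φi * (L * C D φ).coeff 0) * (φi * f) := by
  have e : (C D φ * X D * C D φi) * L * (C D φ * Xi D * C D φi) * C D (φ * D (φi * f)) * Xi D
      = C D φ * X D * C D φi * (L * C D f) * Xi D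
        - C D φ * X D * C D φi * (L * C D φ) * Xi D * C D (φi * f) := by
    calc _ = (C D φ * X D * C D φi) * L *
          (C D φ * Xi D * C D φi * C D (φ * D (φi * f)) * Xi D) := by simp only [mul_assoc]
      _ = _ := by rw [gaugeInv_mul_C_gauge h, mul_sub]; simp only [mul_assoc]
  rw [e, coeff_sub, res_mul_C, res_gauge_mul h, res_gauge_mul h, res_mul_C, res_mul_C]
  linear_combination -(L.coeff (-1) * f) * h

/-- `T u D⁻¹ v T⁻¹` for `T = φ D φ⁻¹`, `∂S = φ v`. -/
theorem gauge_conj_rankOne {u v S : R} (hS : D S = φ * v) :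
    (C D φ * X D * C D φi) * (C D u * Xi D * C D v) * (C D φ * Xi D * C D φi)
      = C D (φ * D (φi * (u * S))) * Xi D * C D φi
        - C D (φ * D (φi * u)) * Xi D * C D (φi * S) := by
  have e : (C D φ * X D * C D φi) * (C D u * Xi D * C D v) * (C D φ * Xi D * C D φi)
      = C D φ * (X D * C D (φi * u) * (Xi D * C D (D S) * Xi D)) * C D φi := by
    rw [hS, mul_comm φ v, C_mul φi, C_mul v]
    simp only [mul_assoc]
  have e1 : X D * C D (φi * u) * (C D S * Xi D) = X D * C D (φi * (u * S)) * Xi D := by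
    rw [← mul_assoc (φi), C_mul _ S]
    simp only [mul_assoc]
  have e2 : X D * C D (φi * u) * (Xi D * C D S) = X D * C D (φi * u) * Xi D * C D S := by
    simp only [mul_assoc]
  rw [e, Xi_C_D_Xi, mul_sub, e1, e2, X_C_Xi, X_C_Xi, add_mul, ← mul_assoc φi u S, C_mul _ S,
    C_mul φ, C_mul φ, C_mul φi S, C_comm φi S]
  noncomm_ring

/-- The negative part of `T P T⁻¹` for a differential operator `P`, `T = φ D φ⁻¹`. -/
theorem gauge_conj_diff {P : Psi D} (hP : IsDiff P) :
    IsDiff ((C D φ * X D * C D φi) * P * (C D φ * Xi D * C D φi)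
      - C D (φ * D (φi * (P * C D φ).coeff 0)) * Xi D * C D φi) := by
  set Y := P * C D φ with hY
  have hYd : IsDiff Y := hP.mul (isDiff_C φ)
  have h1 : IsDiff (Y * Xi D - C D (Y.coeff 0) * Xi D) := fun n hn => by
    rw [coeff_sub, coeff_mul_Xi, coeff_mul_Xi, coeff_C]
    split_ifs with h
    · rw [h, sub_self]
    · rw [hYd _ (by omega), sub_zero]
  have hT : IsDiff (C D φ * X D * C D φi) := ((isDiff_C φ).mul isDiff_X).mul (isDiff_C φi)
  have h2 : (C D φ * X D * C D φi) * P * (C D φ * Xi D * C D φi)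
      - C D (φ * D (φi * Y.coeff 0)) * Xi D * C D φi
      = (C D φ * X D * C D φi) * (Y * Xi D - C D (Y.coeff 0) * Xi D) * C D φi
        + C D φ * C D (φi * Y.coeff 0) * C D φi := by
    have e : (C D φ * X D * C D φi) * (C D (Y.coeff 0) * Xi D) * C D φi
        = C D φ * (X D * C D (φi * Y.coeff 0) * Xi D) * C D φi := by
      rw [C_mul φi]; simp only [mul_assoc]
    rw [mul_sub, sub_mul, e, X_C_Xi, C_mul φ, hY]
    noncomm_ring
  rw [h2]
  exact ((hT.mul h1).mul (isDiff_C φi)).add (((isDiff_C φ).mul (isDiff_C _)).mul (isDiff_C φi))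

/-- `T⁻¹ T = 1`. -/
theorem gaugeInv_mul_gauge (h : φ * φi = 1) :
    (C D φ * Xi D * C D φi) * (C D φ * X D * C D φi) = 1 := by
  have h' : φi * φ = 1 := by rw [mul_comm, h]
  simp only [mul_assoc]
  rw [C_mul_C_inv_assoc h', Xi_X_assoc, C_mul_C_inv h]

end Gauge

/-- Two top coefficients are preserved by a conjugation with a first order operator. -/
theorem top_coeffs_of_intertwine {L L' : Psi D} {r : ℤ} {v : R} (hL : OrdLe L r)
    (hL' : OrdLe L' r) (hlead : L.coeff r = 1 ∨ L'.coeff r = 1)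
    (h : (X D + C D v) * L = L' * (X D + C D v)) :
    L'.coeff r = L.coeff r ∧ L'.coeff (r - 1) = L.coeff (r - 1) := by
  have h1 := congrArg (fun A => A.coeff (r + 1)) h
  have h2 := congrArg (fun A => A.coeff r) h
  simp only [add_mul, mul_add, coeff_add, coeff_X_mul, coeff_mul_X, coeff_C_mul,
    coeff_mul_C_of_ordLe hL'] at h1 h2
  have hv : OrdLe (L' * C D v) r := by simpa using hL'.mul (ordLe_C v)
  rw [hL (r + 1) (by omega), hv (r + 1) (by omega)] at h1
  simp only [add_sub_cancel_right, map_zero, mul_zero, add_zero] at h1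
  have h1' : L.coeff r = 1 := by
    rcases hlead with h | h
    · exact h
    · rw [h1, h]
  -- With both leading coefficients equal to 1, the terms ∂L_r and v L_r - L'_r v drop out of the
  -- comparison at D^r.
  rw [← h1, h1', D.map_one_eq_zero] at h2
  exact ⟨h1.symm, by linear_combination -h2⟩

end Psi

open Psi

/-- In the sums over the index `b` the transformed data follow one pattern except at the index of
the step. The sum is computed as if the pattern held everywhere and is then corrected at that index.
-/
theorem sum_eq_sum_add_sub {ι M : Type*} [Fintype ι] [AddCommGroup M] (a : ι) {F G : ι → M}
    (h : ∀ b, b ≠ a → F b = G b) : ∑ b, F b = ∑ b, G b + (F a - G a) := by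
  classical
  rw [← sub_eq_iff_eq_add', ← Finset.sum_sub_distrib]
  exact Finset.sum_eq_single a (fun b _ hb => by rw [h b hb, sub_self]) (by simp)

theorem sum_sub_mul_sub {ι M : Type*} [Fintype ι] [CommRing M] (x y z t : ι → M) (u w : M) :
    ∑ b, (x b - u * y b) * (z b - w * t b)
      = ∑ b, x b * z b - u * ∑ b, y b * z b - w * ∑ b, t b * x b + u * w * ∑ b, t b * y b := by
  simp only [Finset.mul_sum, ← Finset.sum_sub_distrib, ← Finset.sum_add_distrib]
  exact Finset.sum_congr rfl fun b _ => by ring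

namespace Psi

variable {D : Derivation ℚ R R}

theorem C_zero : C D (0 : R) = 0 := by
  ext n
  simp [coeff_C]

/-- `f ↦ f` as multiplication operator, additively. -/
def CHom (D : Derivation ℚ R R) : R →+ Psi D where
  toFun := C D
  map_zero' := C_zero
  map_add' := C_add

theorem C_sum {ι : Type*} (s : Finset ι) (f : ι → R) :
    C D (∑ i ∈ s, f i) = ∑ i ∈ s, C D (f i) :=
  map_sum (CHom D) f s

end Psi

/-! ### Relations of a constrained KP system free of time derivatives -/

namespace System

variable {m : ℕ}

/-- The time-independent relations of a system of the `cKP` hierarchy. -/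
structure IsStatic (D : Derivation ℚ R R) (r : ℕ) (s : System m R) : Prop where
  form : s.HasLaxForm D r
  prim : s.IsPrimitive D
  bilinear : ∀ i k j l, s.S i (k + 1) j l - s.S i k j (l + 1) - ∑ b, s.S i k b 0 * s.S b 0 j l =
    (Xi D * C D (s.chiStar D j l) * ofPDO D s.L * C D (s.chi D i k) * Xi D).coeff (-1)

variable {D : Derivation ℚ R R} {s : System m R} {r : ℕ}

theorem coeff_zero_mul_chi (s : System m R) (i : Fin m) (k : ℕ) :
    (ofPDO D s.L * C D (s.chi D i k)).coeff 0
      = s.chi D i (k + 1) - ∑ b, s.Φ b * s.S i k b 0 := by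
  rw [← act_eq_coeff, chi, add_sub_cancel_right]

theorem res_chiStar_mul (s : System m R) (j : Fin m) (l : ℕ) :
    (Xi D * C D (s.chiStar D j l) * ofPDO D s.L).coeff (-1)
      = s.chiStar D j (l + 1) + ∑ b, s.Ψ b * s.S b 0 j l := by
  rw [← actAdj_eq_res, chiStar, sub_add_cancel]

theorem HasLaxForm.ordLe (h : s.HasLaxForm D r) : OrdLe (ofPDO D s.L) r := h.high

theorem HasLaxForm.eq_add (h : s.HasLaxForm D r) :
    ofPDO D s.L = ofPDO D s.L.plus + ∑ b, C D (s.Φ b) * Xi D * C D (s.Ψ b) := by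
  ext n
  rw [coeff_add, coeff_sum]
  by_cases hn : n < 0
  · rw [isDiff_plus _ _ hn, zero_add, coeff_ofPDO, h.neg n hn]
    refine Finset.sum_congr rfl fun b _ => ?_
    rw [← ofPDO_mono_neg_one, ← ofPDO_mono_zero, ← ofPDO_mul, coeff_ofPDO]
  · have e : (ofPDO D s.L.plus).coeff n = (ofPDO D s.L).coeff n := if_pos (by omega)
    rw [e, Finset.sum_eq_zero, add_zero]
    intro b _
    exact (((ordLe_C _).mul ordLe_Xi).mul (ordLe_C _)) n (by omega)

theorem hasLaxForm_of (hl : s.L.coeff r = 1) (hs : s.L.coeff (r - 1) = 0)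
    (ho : OrdLe (ofPDO D s.L) r)
    (hd : IsDiff (ofPDO D s.L - ∑ b, C D (s.Φ b) * Xi D * C D (s.Ψ b))) : s.HasLaxForm D r where
  lead := hl
  sub := hs
  high := ho
  neg n hn := by
    have := hd n hn
    rw [coeff_sub, sub_eq_zero, coeff_sum, coeff_ofPDO] at this
    rw [this]
    refine Finset.sum_congr rfl fun b _ => ?_
    rw [← ofPDO_mono_neg_one, ← ofPDO_mono_zero, ← ofPDO_mul, coeff_ofPDO]

end System

/-! ### The Darboux-Bäcklund step -/

section DB

variable {m : ℕ} {D : Derivation ℚ R R} {s : System m R} {r : ℕ} {a : Fin m}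

/-- The label shift caused by a step with index `a`. -/
def shift (a i : Fin m) (k : ℕ) : ℕ := if i = a then k + 1 else k

@[simp] theorem shift_self (a : Fin m) (k : ℕ) : shift a a k = k + 1 := if_pos rfl

theorem shift_of_ne {a i : Fin m} (h : i ≠ a) (k : ℕ) : shift a i k = k := if_neg h

theorem shift_succ (a i : Fin m) (k : ℕ) : shift a i (k + 1) = shift a i k + 1 := by
  unfold shift
  split_ifs <;> rfl

theorem gauge_self {φ : R} (h : IsUnit φ) : gauge D φ φ = 0 := by
  rw [gauge, Ring.inverse_mul_cancel _ h, D.map_one_eq_zero, mul_zero]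

theorem gauge_add (φ f g : R) : gauge D φ (f + g) = gauge D φ f + gauge D φ g := by
  simp only [gauge, mul_add, map_add]

theorem gauge_sub (φ f g : R) : gauge D φ (f - g) = gauge D φ f - gauge D φ g := by
  simp only [gauge, mul_sub, map_sub]

theorem gauge_sum {ι : Type*} (t : Finset ι) (φ : R) (f : ι → R) :
    gauge D φ (∑ i ∈ t, f i) = ∑ i ∈ t, gauge D φ (f i) := by
  simp only [gauge, Finset.mul_sum, map_sum]

theorem gauge_mul {φ : R} (h : IsUnit φ) (u S : R) :
    gauge D φ (u * S) = gauge D φ u * S + u * D S := by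
  rw [gauge, gauge, ← mul_assoc, D.leibniz, smul_eq_mul, smul_eq_mul]
  linear_combination u * D S * Ring.mul_inverse_cancel φ h

theorem ofPDO_db_L : ofPDO D (db D a s).L =
    (C D (s.Φ a) * X D * C D (Ring.inverse (s.Φ a))) * ofPDO D s.L *
      (C D (s.Φ a) * Xi D * C D (Ring.inverse (s.Φ a))) := by
  simp only [db, ofPDO_mul, ofPDO_mono_one, ofPDO_mono_zero, ofPDO_mono_neg_one]

theorem db_Φ (i : Fin m) : (db D a s).Φ i = gauge D (s.Φ a) (s.chi D i (shift a i 0)) := rfl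

theorem db_Ψ_self : (db D a s).Ψ a = Ring.inverse (s.Φ a) := if_pos rfl

theorem db_Ψ_of_ne {i : Fin m} (h : i ≠ a) :
    (db D a s).Ψ i = -(Ring.inverse (s.Φ a) * s.S a 0 i 0) := if_neg h

theorem db_S_of_ne {i j : Fin m} {k l : ℕ} (h : j ≠ a) :
    (db D a s).S i k j l = s.S i (shift a i k) j l
      - Ring.inverse (s.Φ a) * s.chi D i (shift a i k) * s.S a 0 j l := by
  simp [db, shift, h]

theorem db_S_self_zero {i : Fin m} {k : ℕ} :
    (db D a s).S i k a 0 = Ring.inverse (s.Φ a) * s.chi D i (shift a i k) := by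
  simp [db, shift]

theorem db_S_self_succ {i : Fin m} {k l : ℕ} :
    (db D a s).S i k a (l + 1) = s.S i (shift a i k) a l
      - Ring.inverse (s.Φ a) * s.chi D i (shift a i k) * s.S a 0 a l := by
  simp [db, shift]

/-- `χ_i^{(k)}` of the transformed system. -/
theorem chi_db (hs : s.IsStatic D r) (hu : IsUnit (s.Φ a)) (i : Fin m) (k : ℕ) :
    (db D a s).chi D i k = gauge D (s.Φ a) (s.chi D i (shift a i k)) := by
  induction k with
  | zero => rfl
  | succ k ih =>
    have hφ := Ring.mul_inverse_cancel _ hu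
    rw [System.chi, ih, act_eq_res, ofPDO_db_L]
    rw [show gauge D (s.Φ a) (s.chi D i (shift a i k)) = s.Φ a * D (Ring.inverse (s.Φ a) *
      s.chi D i (shift a i k)) from rfl, act_gauge_conj hφ, System.coeff_zero_mul_chi,
      show s.Φ a = s.chi D a 0 from rfl, System.coeff_zero_mul_chi,
      show s.chi D a 0 = s.Φ a from rfl, shift_succ]
    change gauge D _ _ - gauge D _ _ * _ + _ = _
    -- At b = a the generic term vanishes because T(Φ_a) = 0, and the actual term T(L(Φ_a)) f/Φ_a
    -- cancels the one produced by `act_gauge_conj`.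
    rw [sum_eq_sum_add_sub a (F := fun b => (db D a s).Φ b * (db D a s).S i k b 0)
      (G := fun b => gauge D (s.Φ a) (s.Φ b) * (s.S i (shift a i k) b 0
      - Ring.inverse (s.Φ a) * s.chi D i (shift a i k) * s.S a 0 b 0)), db_S_self_zero, db_Φ,
      shift_self, gauge_self hu, gauge_sub, gauge_sub, gauge_sum, gauge_sum]
    -- Pulling the potentials under `T` creates terms Φ_b ∂S; those from S(f, Ψ_b) and from S(Φ_a,
    -- Ψ_b) f/Φ_a are both Φ_b f Ψ_b and cancel.
    · have key : ∀ b, gauge D (s.Φ a) (s.Φ b) * (s.S i (shift a i k) b 0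
          - Ring.inverse (s.Φ a) * s.chi D i (shift a i k) * s.S a 0 b 0)
          = gauge D (s.Φ a) (s.Φ b * s.S i (shift a i k) b 0)
            - gauge D (s.Φ a) (s.Φ b * s.S a 0 b 0) *
              (Ring.inverse (s.Φ a) * s.chi D i (shift a i k)) := fun b => by
        rw [gauge_mul hu, gauge_mul hu, hs.prim, hs.prim,
          show s.chi D a 0 = s.Φ a from rfl]
        linear_combination (s.Φ b * s.chi D i (shift a i k) * s.chiStar D b 0) * hφ
      rw [Finset.sum_congr rfl fun b _ => key b, Finset.sum_sub_distrib, ← Finset.sum_mul]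
      ring
    · intro b hb
      rw [db_S_of_ne hb, db_Φ, shift_of_ne hb]
      rfl

/-- One application of the new L^* raises the label of -S(Φ_a, χ_j^{*(p)})/Φ_a. The residue that
appears is the right side of the bilinear identity for the pair (Φ_a, χ_j^{*(p)}), which supplies
S(Φ_a, L^* g); its other term S(L(Φ_a), g) cancels against the summand b = a. The potentials are
written out explicitly so that the lemma serves both j ≠ a and the shifted tower at `a`. -/
theorem db_actAdj_step (hs : s.IsStatic D r) (hu : IsUnit (s.Φ a)) (j : Fin m) (p : ℕ) :
    (db D a s).L.actAdj D (-(Ring.inverse (s.Φ a) * s.S a 0 j p))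
      - ∑ b, (db D a s).Ψ b * (s.S b (shift a b 0) j p
        - Ring.inverse (s.Φ a) * s.chi D b (shift a b 0) * s.S a 0 j p)
      = -(Ring.inverse (s.Φ a) * s.S a 0 j (p + 1)) := by
  have hφ := Ring.mul_inverse_cancel _ hu
  have hσ : D (s.S a 0 j p) = s.Φ a * s.chiStar D j p := hs.prim a 0 j p
  have hb := hs.bilinear a 0 j p
  have hc := System.coeff_zero_mul_chi (D := D) s a 0
  simp only [show s.chi D a 0 = s.Φ a from rfl, zero_add] at hb hc
  rw [actAdj_eq_res, ofPDO_db_L]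
  have e : Xi D * C D (-(Ring.inverse (s.Φ a) * s.S a 0 j p)) *
      (C D (s.Φ a) * X D * C D (Ring.inverse (s.Φ a)) * ofPDO D s.L *
        (C D (s.Φ a) * Xi D * C D (Ring.inverse (s.Φ a))))
      = (Xi D * C D (s.chiStar D j p) * ofPDO D s.L * C D (s.Φ a) * Xi D
          - C D (Ring.inverse (s.Φ a) * s.S a 0 j p) * (ofPDO D s.L * C D (s.Φ a) * Xi D))
        * C D (Ring.inverse (s.Φ a)) := by
    calc _ = Xi D * C D (-(Ring.inverse (s.Φ a) * s.S a 0 j p)) *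
        (C D (s.Φ a) * X D * C D (Ring.inverse (s.Φ a))) * (ofPDO D s.L *
        (C D (s.Φ a) * Xi D * C D (Ring.inverse (s.Φ a)))) := by simp only [mul_assoc]
      _ = _ := by
        rw [Xi_mul_C_mul_gauge hφ hσ, sub_mul, sub_mul]
        simp only [mul_assoc]
  rw [e, res_mul_C, coeff_sub, ← hb, coeff_C_mul, coeff_mul_Xi, neg_add_cancel, hc,
    sum_eq_sum_add_sub a (F := fun b => (db D a s).Ψ b * (s.S b (shift a b 0) j p
        - Ring.inverse (s.Φ a) * s.chi D b (shift a b 0) * s.S a 0 j p)) (G := fun b => (0 - Ring.inverse (s.Φ a) * s.S a 0 b 0) *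
      (s.S b 0 j p - Ring.inverse (s.Φ a) * s.S a 0 j p * s.Φ b)), sum_sub_mul_sub,
    db_Ψ_self, shift_self]
  · simp only [zero_mul, mul_zero, Finset.sum_const_zero, zero_add]
    linear_combination (Ring.inverse (s.Φ a) * s.S a 0 a 0 * s.S a 0 j p) * hφ
  · intro b hb
    rw [db_Ψ_of_ne hb, shift_of_ne hb, show s.chi D b 0 = s.Φ b from rfl]
    ring

/-- Entry point of the tower at `a`. Since D⁻¹ Φ_a⁻¹ T = Φ_a⁻¹, only L₊(Φ_a) enters and no bilinear
identity is required. -/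
theorem db_actAdj_inv (hu : IsUnit (s.Φ a)) :
    (db D a s).L.actAdj D (Ring.inverse (s.Φ a))
      - ∑ b, (db D a s).Ψ b * (Ring.inverse (s.Φ a) * s.chi D b (shift a b 0))
      = -(Ring.inverse (s.Φ a) * s.S a 0 a 0) := by
  have hφ := Ring.mul_inverse_cancel _ hu
  have hc := System.coeff_zero_mul_chi (D := D) s a 0
  simp only [show s.chi D a 0 = s.Φ a from rfl, zero_add] at hc
  rw [actAdj_eq_res, ofPDO_db_L]
  have e : Xi D * C D (Ring.inverse (s.Φ a)) *
      (C D (s.Φ a) * X D * C D (Ring.inverse (s.Φ a)) * ofPDO D s.L *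
        (C D (s.Φ a) * Xi D * C D (Ring.inverse (s.Φ a))))
      = C D (Ring.inverse (s.Φ a)) * (ofPDO D s.L * C D (s.Φ a) * Xi D)
        * C D (Ring.inverse (s.Φ a)) := by
    calc _ = Xi D * C D (Ring.inverse (s.Φ a)) *
        (C D (s.Φ a) * X D * C D (Ring.inverse (s.Φ a))) * (ofPDO D s.L *
        (C D (s.Φ a) * Xi D * C D (Ring.inverse (s.Φ a)))) := by simp only [mul_assoc]
      _ = _ := by
        rw [Xi_mul_C_inv_mul_gauge hφ]
        simp only [mul_assoc]
  rw [e, res_mul_C, coeff_C_mul, coeff_mul_Xi, neg_add_cancel, hc,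
    sum_eq_sum_add_sub a
      (F := fun b => (db D a s).Ψ b * (Ring.inverse (s.Φ a) * s.chi D b (shift a b 0)))
      (G := fun b => -Ring.inverse (s.Φ a) ^ 2 * (s.Φ b * s.S a 0 b 0)),
    ← Finset.mul_sum, db_Ψ_self, shift_self]
  · linear_combination (-(Ring.inverse (s.Φ a) * s.S a 0 a 0)) * hφ
  · intro b hb
    rw [db_Ψ_of_ne hb, shift_of_ne hb, show s.chi D b 0 = s.Φ b from rfl]
    ring

/-- `χ_j^{*(l)}` of the transformed system, `j ≠ a`. -/
theorem chiStar_db_of_ne (hs : s.IsStatic D r) (hu : IsUnit (s.Φ a)) {j : Fin m} (hj : j ≠ a)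
    (l : ℕ) : (db D a s).chiStar D j l = -(Ring.inverse (s.Φ a) * s.S a 0 j l) := by
  induction l with
  | zero => exact db_Ψ_of_ne hj
  | succ l ih =>
    rw [System.chiStar, ih, ← db_actAdj_step hs hu]
    simp only [db_S_of_ne hj]

/-- The new Ψ_a is 1/Φ_a, and below it the old tower reappears one label higher: `db_actAdj_inv`
starts it and `db_actAdj_step` continues it. -/
theorem chiStar_db_self_succ (hs : s.IsStatic D r) (hu : IsUnit (s.Φ a)) (l : ℕ) :
    (db D a s).chiStar D a (l + 1) = -(Ring.inverse (s.Φ a) * s.S a 0 a l) := by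
  induction l with
  | zero =>
    rw [System.chiStar, System.chiStar, db_Ψ_self, ← db_actAdj_inv (D := D) hu]
    simp only [db_S_self_zero]
  | succ l ih =>
    rw [System.chiStar, ih, ← db_actAdj_step hs hu]
    simp only [db_S_self_succ]

theorem chiStar_db_self_zero : (db D a s).chiStar D a 0 = Ring.inverse (s.Φ a) := db_Ψ_self

theorem isPrimitive_db (hs : s.IsStatic D r) (hu : IsUnit (s.Φ a)) :
    (db D a s).IsPrimitive D := by
  intro i k j l
  have hφ := Ring.mul_inverse_cancel _ hu
  rw [chi_db hs hu, gauge]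
  have key : ∀ j p, D (s.S i (shift a i k) j p
      - Ring.inverse (s.Φ a) * s.chi D i (shift a i k) * s.S a 0 j p)
      = s.Φ a * D (Ring.inverse (s.Φ a) * s.chi D i (shift a i k)) *
        -(Ring.inverse (s.Φ a) * s.S a 0 j p) := fun j p => by
    have h0 : s.chi D a 0 = s.Φ a := rfl
    rw [map_sub, hs.prim, D.leibniz (_ * _), smul_eq_mul, smul_eq_mul, hs.prim, h0]
    linear_combination (D (Ring.inverse (s.Φ a) * s.chi D i (shift a i k)) * s.S a 0 j p
      - s.chi D i (shift a i k) * s.chiStar D j p) * hφ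
  by_cases hj : j = a
  · subst hj
    cases l with
    | zero =>
      rw [db_S_self_zero, chiStar_db_self_zero]
      linear_combination -D (Ring.inverse (s.Φ j) * s.chi D i (shift j i k)) * hφ
    | succ l => rw [db_S_self_succ, chiStar_db_self_succ hs hu, key]
  · rw [db_S_of_ne hj, chiStar_db_of_ne hs hu hj, key]

/-- The two rules for `T` split the residue into four pieces: two are residues of the old system,
rewritten by its bilinear identity for the pairs (f, g) and (Φ_a, g), and two are values L₊(f),
L₊(Φ_a). Preserving this identity is what allows the steps to be iterated. -/
theorem bilinear_db (hs : s.IsStatic D r) (hu : IsUnit (s.Φ a)) (i : Fin m) (k : ℕ) (j : Fin m)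
    (l : ℕ) : (db D a s).S i (k + 1) j l - (db D a s).S i k j (l + 1)
        - ∑ b, (db D a s).S i k b 0 * (db D a s).S b 0 j l =
      (Xi D * C D ((db D a s).chiStar D j l) * ofPDO D (db D a s).L *
        C D ((db D a s).chi D i k) * Xi D).coeff (-1) := by
  have hφ := Ring.mul_inverse_cancel _ hu
  set φ := s.Φ a with hφdef
  set φi := Ring.inverse φ with hφi
  set f := s.chi D i (shift a i k) with hf
  have h0 : s.chi D a 0 = φ := rfl
  have e (G : R) : Xi D * C D G * ofPDO D (db D a s).L * C D ((db D a s).chi D i k) * Xi D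
      = (Xi D * C D G * (C D φ * X D * C D φi)) * ofPDO D s.L * C D f * Xi D
        - (Xi D * C D G * (C D φ * X D * C D φi)) * ofPDO D s.L * C D φ * Xi D * C D (φi * f) := by
    rw [ofPDO_db_L, chi_db hs hu, gauge]
    calc _ = (Xi D * C D G * (C D φ * X D * C D φi)) * ofPDO D s.L *
          (C D φ * Xi D * C D φi * C D (φ * D (φi * f)) * Xi D) := by simp only [mul_assoc]; rfl
      _ = _ := by rw [gaugeInv_mul_C_gauge hφ, mul_sub]; simp only [mul_assoc]
  have hcf := System.coeff_zero_mul_chi (D := D) s i (shift a i k)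
  have hca := System.coeff_zero_mul_chi (D := D) s a 0
  rw [← hf] at hcf
  rw [h0, zero_add] at hca
  -- Covers all adjoint functions of the form -S(Φ_a, g)/Φ_a, hence every label except (a, 0), where
  -- the function is 1/Φ_a.
  have key : ∀ j p, s.S i (shift a i k + 1) j p - φi * s.chi D i (shift a i k + 1) * s.S a 0 j p
      - (s.S i (shift a i k) j (p + 1) - φi * f * s.S a 0 j (p + 1))
      - ∑ b, (db D a s).S i k b 0 *
        (s.S b (shift a b 0) j p - φi * s.chi D b (shift a b 0) * s.S a 0 j p)
      = (Xi D * C D (-(φi * s.S a 0 j p)) * ofPDO D (db D a s).L *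
        C D ((db D a s).chi D i k) * Xi D).coeff (-1) := fun j p => by
    have hσ : D (s.S a 0 j p) = φ * s.chiStar D j p := hs.prim a 0 j p
    have hbf := hs.bilinear i (shift a i k) j p
    have hba := hs.bilinear a 0 j p
    rw [h0, zero_add] at hba
    rw [← hf] at hbf
    rw [e, Xi_mul_C_mul_gauge hφ hσ, coeff_sub, res_mul_C]
    simp only [sub_mul, coeff_sub]
    rw [← hbf, ← hba, mul_assoc (C D _), mul_assoc (C D _), mul_assoc (C D _), mul_assoc (C D _),
      coeff_C_mul, coeff_C_mul, coeff_mul_Xi, coeff_mul_Xi, neg_add_cancel, hcf, hca,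
      sum_eq_sum_add_sub a (G := fun b => (s.S i (shift a i k) b 0 - φi * f * s.S a 0 b 0) *
        (s.S b 0 j p - φi * s.S a 0 j p * s.Φ b)), sum_sub_mul_sub, db_S_self_zero, shift_self]
    · linear_combination (-(s.S i (shift a i k) a 0 - φi * f * s.S a 0 a 0) * s.S a 0 j p) * hφ
    · intro b hb
      rw [db_S_of_ne hb, shift_of_ne hb, show s.chi D b 0 = s.Φ b from rfl]
      ring
  by_cases hj : j = a
  · cases l with
    | zero =>
      rw [hj, chiStar_db_self_zero, e, Xi_mul_C_inv_mul_gauge hφ, coeff_sub, res_mul_C,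
        mul_assoc (C D _), mul_assoc (C D _), mul_assoc (C D _), mul_assoc (C D _),
        coeff_C_mul, coeff_C_mul, coeff_mul_Xi, coeff_mul_Xi, neg_add_cancel, hcf, hca,
        sum_eq_sum_add_sub a (G := fun b => φi * (s.Φ b * s.S i (shift a i k) b 0)
          - φi * (φi * f) * (s.Φ b * s.S a 0 b 0)), Finset.sum_sub_distrib, ← Finset.mul_sum,
        ← Finset.mul_sum, db_S_self_zero, db_S_self_zero, db_S_self_zero, db_S_self_succ,
        shift_self, shift_succ]
      · linear_combination (s.S i (shift a i k) a 0 - φi * f * s.S a 0 a 0) * hφ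
      · intro b hb
        rw [db_S_of_ne hb, db_S_self_zero, shift_of_ne hb, show s.chi D b 0 = s.Φ b from rfl]
        ring
    | succ l =>
      rw [hj, chiStar_db_self_succ hs hu, ← key]
      simp only [db_S_self_succ, shift_succ]
      rfl
  · rw [chiStar_db_of_ne hs hu hj, ← key]
    simp only [db_S_of_ne hj, shift_succ]
    rfl

/-- In T L T⁻¹ the differential part and every Φ_b D⁻¹ Ψ_b contribute a term ending in D⁻¹ Φ_a⁻¹;
together these have left factor T(L(Φ_a)). The remaining terms are T(Φ_b) D⁻¹ T^{*-1}(Ψ_b), and the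
one with b = a vanishes. -/
theorem hasLaxForm_db (hs : s.IsStatic D r) (hu : IsUnit (s.Φ a)) :
    (db D a s).HasLaxForm D r := by
  have hφ := Ring.mul_inverse_cancel _ hu
  have ho : OrdLe (ofPDO D (db D a s).L) r := by
    rw [ofPDO_db_L]
    have := ((((ordLe_C (D := D) (s.Φ a)).mul ordLe_X).mul (ordLe_C (Ring.inverse (s.Φ a)))).mul
      hs.form.ordLe).mul (((ordLe_C (s.Φ a)).mul ordLe_Xi).mul (ordLe_C (Ring.inverse (s.Φ a))))
    exact this.mono (by omega)
  -- `T` is monic of first order, so T L = L' T fixes the two top coefficients of L'.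
  have hT : C D (s.Φ a) * X D * C D (Ring.inverse (s.Φ a))
      = X D + C D (s.Φ a * D (Ring.inverse (s.Φ a))) := by
    rw [C_X_C, hφ, C_one, one_mul]
  have hint : (X D + C D (s.Φ a * D (Ring.inverse (s.Φ a)))) * ofPDO D s.L
      = ofPDO D (db D a s).L * (X D + C D (s.Φ a * D (Ring.inverse (s.Φ a)))) := by
    rw [← hT, ofPDO_db_L, mul_assoc _ _ (C D (s.Φ a) * X D * C D (Ring.inverse (s.Φ a))),
      gaugeInv_mul_gauge hφ, mul_one]
  obtain ⟨h1, h2⟩ := top_coeffs_of_intertwine hs.form.ordLe ho (Or.inl hs.form.lead) hint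
  refine System.hasLaxForm_of (h1.trans hs.form.lead) (h2.trans hs.form.sub) ho ?_
  have hc : s.chi D a 1 = s.L.act D (s.chi D a 0) + ∑ b, s.Φ b * s.S a 0 b 0 := rfl
  rw [← act_plus, act_eq_coeff, show s.chi D a 0 = s.Φ a from rfl] at hc
  have hdiff := gauge_conj_diff (φ := s.Φ a) (φi := Ring.inverse (s.Φ a))
    (isDiff_plus (D := D) s.L)
  have hp : ∀ b, D (s.S a 0 b 0) = s.Φ a * s.Ψ b := fun b => hs.prim a 0 b 0
  convert hdiff using 1
  rw [ofPDO_db_L, hs.form.eq_add, mul_add, add_mul, Finset.mul_sum, Finset.sum_mul]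
  rw [Finset.sum_congr rfl fun b _ =>
      gauge_conj_rankOne (u := s.Φ b) (φi := Ring.inverse (s.Φ a)) (hp b),
    Finset.sum_sub_distrib, ← Finset.sum_mul, ← Finset.sum_mul, ← C_sum,
    sum_eq_sum_add_sub a (F := fun b => C D ((db D a s).Φ b) * Xi D * C D ((db D a s).Ψ b))
      (G := fun b => -(C D (gauge D (s.Φ a) (s.Φ b)) * Xi D *
      C D (Ring.inverse (s.Φ a) * s.S a 0 b 0)))]
  · rw [db_Φ, shift_self, db_Ψ_self, gauge_self hu, C_zero, zero_add, hc, gauge_add, C_add,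
      gauge_sum, Finset.sum_neg_distrib]
    simp only [gauge]
    noncomm_ring
  · intro b hb
    rw [db_Φ, shift_of_ne hb, db_Ψ_of_ne hb, C_neg, mul_neg]
    rfl

theorem isStatic_db (hs : s.IsStatic D r) (hu : IsUnit (s.Φ a)) : (db D a s).IsStatic D r :=
  ⟨hasLaxForm_db hs hu, isPrimitive_db hs hu, bilinear_db hs hu⟩

end DB

namespace Psi

variable {D : Derivation ℚ R R} {ψ ψi : R}

/-! ### Conjugation by `U = -ψ⁻¹ D ψ` -/

/-- `U f' D⁻¹ = σ/ψ + f D⁻¹` for `f' = -σ/ψ`, `∂σ = f ψ`. -/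
theorem adjGauge_mul_C (h : ψ * ψi = 1) {σ f : R} (hσ : D σ = f * ψ) :
    C D (-ψi) * X D * C D ψ * C D (-(ψi * σ)) * Xi D = C D (ψi * σ) + C D f * Xi D := by
  have e : C D (-ψi) * X D * C D ψ * C D (-(ψi * σ)) * Xi D
      = C D (-ψi) * (X D * C D (ψ * -(ψi * σ)) * Xi D) := by
    rw [C_mul ψ]; simp only [mul_assoc]
  have e1 : ψ * -(ψi * σ) = -σ := by linear_combination -σ * h
  have e2 : -ψi * -(f * ψ) = f := by linear_combination f * h
  rw [e, e1, X_C_Xi, map_neg, hσ, mul_add, ← mul_assoc, ← C_mul, ← C_mul, e2, neg_mul_neg]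

theorem adjGauge_mul_C_inv (h : ψ * ψi = 1) :
    C D (-ψi) * X D * C D ψ * C D (-ψi) * Xi D = C D ψi := by
  have e : C D (-ψi) * X D * C D ψ * C D (-ψi) * Xi D
      = C D (-ψi) * (X D * C D (ψ * -ψi) * Xi D) := by
    rw [C_mul ψ]; simp only [mul_assoc]
  rw [e, mul_neg, h, C_neg, C_neg, C_one]
  simp

/-- `D⁻¹ g' U⁻¹ = D⁻¹ g - (g/ψ) D⁻¹ ψ` for `g' = ψ ∂(g/ψ)`. -/
theorem Xi_mul_C_gauge_mul_adjGaugeInv (h : ψ * ψi = 1) (g : R) :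
    Xi D * C D (ψ * D (ψi * g)) * (C D (-ψi) * Xi D * C D ψ)
      = Xi D * C D g - C D (ψi * g) * Xi D * C D ψ := by
  have e : Xi D * C D (ψ * D (ψi * g)) * (C D (-ψi) * Xi D * C D ψ)
      = Xi D * C D (ψ * D (ψi * g) * -ψi) * Xi D * C D ψ := by
    rw [C_mul _ (-ψi)]; simp only [mul_assoc]
  have e1 : ψ * D (ψi * g) * -ψi = D (-(ψi * g)) := by
    rw [map_neg]; linear_combination -D (ψi * g) * h
  have e2 : -(ψi * g) * ψ = -g := by linear_combination -g * h
  rw [e, e1, Xi_C_D_Xi, sub_mul, mul_assoc (Xi D), ← C_mul, e2, C_neg, C_neg]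
  noncomm_ring

theorem res_mul_adjGauge (h : ψ * ψi = 1) (L : Psi D) (g : R) :
    (Xi D * C D g * L * (C D (-ψi) * X D * C D ψ)).coeff (-1)
      = -(g * L.coeff (-1)) + ψ * D (ψi * (Xi D * C D g * L).coeff (-1)) := by
  set Y := Xi D * C D g * L with hY
  -- The coefficient of D⁻¹ in D Y = g L.
  have h1 : Y.coeff (-2) + D (Y.coeff (-1)) = g * L.coeff (-1) := by
    rw [← coeff_C_mul]
    have := coeff_X_mul Y (-1)
    rw [hY, mul_assoc (Xi D), X_Xi_assoc, ← mul_assoc, ← hY] at this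
    rw [this]
    norm_num
  -- Commuting ψ⁻¹ past `D` moves all functions to the right end, where the residue is linear.
  have e : Y * (C D (-ψi) * X D * C D ψ) = (Y * C D (D ψi) - Y * X D * C D ψi) * C D ψ := by
    rw [C_D, C_neg]
    noncomm_ring
  rw [e, res_mul_C, coeff_sub, res_mul_C, res_mul_C, coeff_mul_X, D.leibniz, smul_eq_mul,
    smul_eq_mul, ← h1]
  norm_num
  linear_combination (-(Y.coeff (-2)) - D (Y.coeff (-1))) * h

/-- The adjoint action of `U⁻¹ L U` on `ψ ∂(g/ψ)`. -/
theorem actAdj_adjGauge_conj (h : ψ * ψi = 1) (L : Psi D) (g : R) :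
    (Xi D * C D (ψ * D (ψi * g)) *
      ((C D (-ψi) * Xi D * C D ψ) * L * (C D (-ψi) * X D * C D ψ))).coeff (-1)
      = ψ * D (ψi * (Xi D * C D g * L).coeff (-1))
        - ψi * g * (ψ * D (ψi * (Xi D * C D ψ * L).coeff (-1))) := by
  have e : Xi D * C D (ψ * D (ψi * g)) *
      ((C D (-ψi) * Xi D * C D ψ) * L * (C D (-ψi) * X D * C D ψ))
      = Xi D * C D g * L * (C D (-ψi) * X D * C D ψ)
        - C D (ψi * g) * (Xi D * C D ψ * L * (C D (-ψi) * X D * C D ψ)) := by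
    calc _ = Xi D * C D (ψ * D (ψi * g)) * (C D (-ψi) * Xi D * C D ψ) *
          (L * (C D (-ψi) * X D * C D ψ)) := by simp only [mul_assoc]
      _ = _ := by rw [Xi_mul_C_gauge_mul_adjGaugeInv h, sub_mul]; simp only [mul_assoc]
  rw [e, coeff_sub, coeff_C_mul, res_mul_adjGauge h, res_mul_adjGauge h]
  linear_combination g * L.coeff (-1) * h

/-- `U⁻¹ u D⁻¹ v U` for `∂S = u ψ`. -/
theorem adjGauge_conj_rankOne {u v S : R} (hS : D S = u * ψ) :
    (C D (-ψi) * Xi D * C D ψ) * (C D u * Xi D * C D v) * (C D (-ψi) * X D * C D ψ)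
      = C D ψi * Xi D * C D (ψ * D (ψi * (v * S)))
        - C D (ψi * S) * Xi D * C D (ψ * D (ψi * v)) := by
  have e : (C D (-ψi) * Xi D * C D ψ) * (C D u * Xi D * C D v) * (C D (-ψi) * X D * C D ψ)
      = C D ψi * ((Xi D * C D (D S) * Xi D) * (C D (ψi * v) * X D)) * C D ψ := by
    rw [hS, mul_comm u ψ, C_mul ψi, C_comm ψi v, C_mul ψ, C_neg]
    noncomm_ring
  have e1 : C D S * Xi D * (C D (ψi * v) * X D) = C D S * (Xi D * C D (ψi * v) * X D) := by
    simp only [mul_assoc]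
  have e2 : Xi D * C D S * (C D (ψi * v) * X D) = Xi D * C D (ψi * (v * S)) * X D := by
    rw [← mul_assoc ψi, C_mul _ S, C_comm _ S]
    simp only [mul_assoc]
  rw [e, Xi_C_D_Xi, sub_mul, e1, e2, Xi_C_X, Xi_C_X, ← mul_assoc ψi v S, C_mul _ S, C_mul ψ,
    C_mul ψ, C_mul ψi S, C_comm ψ, C_comm ψ, C_comm _ S]
  noncomm_ring

/-- The negative part of `U⁻¹ P U` for a differential operator `P`. -/
theorem adjGauge_conj_diff {P : Psi D} (hP : IsDiff P) :
    IsDiff ((C D (-ψi) * Xi D * C D ψ) * P * (C D (-ψi) * X D * C D ψ)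
      - C D (-ψi) * Xi D * C D (ψ * D (ψi * (Xi D * C D ψ * P).coeff (-1)))) := by
  set q := (Xi D * C D ψ * P).coeff (-1) with hq
  set Z := Xi D * C D ψ * P - Xi D * C D q with hZ
  -- D Z is differential, so Z_{n-1} = -∂Z_n for n < 0. Subtracting D⁻¹ q has killed the residue of
  -- `Z`, and the recursion then kills every lower coefficient.
  have hXZ : IsDiff (X D * Z) := by
    rw [hZ, mul_sub, mul_assoc, X_Xi_assoc, X_Xi_assoc, sub_eq_add_neg]
    exact ((isDiff_C ψ).mul hP).add (isDiff_C q).neg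
  have hZ1 : Z.coeff (-1) = 0 := by
    rw [hZ, coeff_sub, res_mul_C, ← hq, Xi, coeff_mono, if_pos rfl, one_mul, sub_self]
  have hZk : ∀ k : ℕ, Z.coeff (-1 - k) = 0 := fun k => by
    induction k with
    | zero => simpa using hZ1
    | succ k ih =>
      have := hXZ (-1 - k) (by omega)
      rw [coeff_X_mul, ih, map_zero, add_zero] at this
      rw [← this]
      congr 1
      push_cast
      ring
  have hZd : IsDiff Z := fun n hn => by
    have := hZk (-1 - n).toNat
    rwa [Int.toNat_of_nonneg (by omega), sub_sub_cancel] at this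
  have hU : IsDiff (C D (-ψi) * X D * C D ψ) := ((isDiff_C _).mul isDiff_X).mul (isDiff_C _)
  have h2 : (C D (-ψi) * Xi D * C D ψ) * P * (C D (-ψi) * X D * C D ψ)
      - C D (-ψi) * Xi D * C D (ψ * D (ψi * q))
      = C D (-ψi) * Z * (C D (-ψi) * X D * C D ψ) + C D ψi * C D (ψi * q) * C D ψ := by
    have e : C D (-ψi) * (Xi D * C D q) * (C D (-ψi) * X D * C D ψ)
        = C D ψi * (Xi D * C D (ψi * q) * X D) * C D ψ := by
      rw [C_mul ψi, C_comm ψi q, C_neg]; noncomm_ring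
    rw [hZ, mul_sub, sub_mul, e, Xi_C_X, C_neg, C_mul ψ, C_comm ψ]
    noncomm_ring
  rw [h2]
  exact (((isDiff_C _).mul hZd).mul hU).add (((isDiff_C _).mul (isDiff_C _)).mul (isDiff_C _))

theorem adjGauge_mul_adjGaugeInv (h : ψ * ψi = 1) :
    (C D (-ψi) * X D * C D ψ) * (C D (-ψi) * Xi D * C D ψ) = 1 := by
  have h' : ψi * ψ = 1 := by rw [mul_comm, h]
  rw [C_neg]
  simp only [mul_assoc, neg_mul, mul_neg, neg_neg]
  rw [C_mul_C_inv_assoc h, X_Xi_assoc, C_mul_C_inv h']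

end Psi

/-! ### The adjoint Darboux-Bäcklund step -/

section ADB

variable {m : ℕ} {D : Derivation ℚ R R} {s : System m R} {r : ℕ} {b : Fin m}

theorem ofPDO_adb_L : ofPDO D (adb D b s).L =
    (C D (-Ring.inverse (s.Ψ b)) * Xi D * C D (s.Ψ b)) * ofPDO D s.L *
      (C D (-Ring.inverse (s.Ψ b)) * X D * C D (s.Ψ b)) := by
  simp only [adb, ofPDO_mul, ofPDO_mono_one, ofPDO_mono_zero, ofPDO_mono_neg_one]

theorem adb_Ψ (j : Fin m) :
    (adb D b s).Ψ j = gauge D (s.Ψ b) (s.chiStar D j (shift b j 0)) := rfl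

theorem adb_Φ_self : (adb D b s).Φ b = -Ring.inverse (s.Ψ b) := if_pos rfl

theorem adb_Φ_of_ne {i : Fin m} (h : i ≠ b) :
    (adb D b s).Φ i = -(Ring.inverse (s.Ψ b) * s.S i 0 b 0) := if_neg h

theorem adb_S_of_ne {i j : Fin m} {k l : ℕ} (h : i ≠ b) :
    (adb D b s).S i k j l = s.S i k j (shift b j l)
      - s.S i k b 0 * (Ring.inverse (s.Ψ b) * s.chiStar D j (shift b j l)) := by
  simp [adb, shift, h]

theorem adb_S_self_zero {j : Fin m} {l : ℕ} :
    (adb D b s).S b 0 j l = -(Ring.inverse (s.Ψ b) * s.chiStar D j (shift b j l)) := by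
  simp [adb, shift]

theorem adb_S_self_succ {j : Fin m} {k l : ℕ} :
    (adb D b s).S b (k + 1) j l = s.S b k j (shift b j l)
      - s.S b k b 0 * (Ring.inverse (s.Ψ b) * s.chiStar D j (shift b j l)) := by
  simp [adb, shift]

/-- `χ_j^{*(l)}` of the transformed system. -/
theorem chiStar_adb (hs : s.IsStatic D r) (hu : IsUnit (s.Ψ b)) (j : Fin m) (l : ℕ) :
    (adb D b s).chiStar D j l = gauge D (s.Ψ b) (s.chiStar D j (shift b j l)) := by
  induction l with
  | zero => rfl
  | succ l ih =>
    have hψ := Ring.mul_inverse_cancel _ hu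
    rw [System.chiStar, ih, actAdj_eq_res, ofPDO_adb_L]
    rw [show gauge D (s.Ψ b) (s.chiStar D j (shift b j l)) = s.Ψ b * D (Ring.inverse (s.Ψ b) *
      s.chiStar D j (shift b j l)) from rfl, actAdj_adjGauge_conj hψ, System.res_chiStar_mul,
      show s.Ψ b = s.chiStar D b 0 from rfl, System.res_chiStar_mul,
      show s.chiStar D b 0 = s.Ψ b from rfl, shift_succ]
    change gauge D _ _ - _ * gauge D _ _ - _ = _
    rw [sum_eq_sum_add_sub b (F := fun c => (adb D b s).Ψ c * (adb D b s).S c 0 j l)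
      (G := fun c => gauge D (s.Ψ b) (s.Ψ c) * (s.S c 0 j (shift b j l)
      - s.S c 0 b 0 * (Ring.inverse (s.Ψ b) * s.chiStar D j (shift b j l)))), adb_S_self_zero,
      adb_Ψ, shift_self, gauge_self hu, gauge_add, gauge_add, gauge_sum, gauge_sum]
    · have key : ∀ c, gauge D (s.Ψ b) (s.Ψ c) * (s.S c 0 j (shift b j l)
          - s.S c 0 b 0 * (Ring.inverse (s.Ψ b) * s.chiStar D j (shift b j l)))
          = gauge D (s.Ψ b) (s.Ψ c * s.S c 0 j (shift b j l))
            - gauge D (s.Ψ b) (s.Ψ c * s.S c 0 b 0) *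
              (Ring.inverse (s.Ψ b) * s.chiStar D j (shift b j l)) := fun c => by
        rw [gauge_mul hu, gauge_mul hu, hs.prim, hs.prim,
          show s.chiStar D b 0 = s.Ψ b from rfl]
        linear_combination (s.Ψ c * s.chiStar D j (shift b j l) * s.chi D c 0) * hψ
      rw [Finset.sum_congr rfl fun c _ => key c, Finset.sum_sub_distrib, ← Finset.sum_mul]
      ring
    · intro c hc
      rw [adb_S_of_ne hc, adb_Ψ, shift_of_ne hc]
      rfl

/-- Mirror of `db_actAdj_step`: the bilinear identity for (χ_i^{(p)}, Ψ_b) produces S(L f, Ψ_b), and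
its term S(f, L^*(Ψ_b)) cancels against the summand c = b. -/
theorem adb_act_step (hs : s.IsStatic D r) (hu : IsUnit (s.Ψ b)) (i : Fin m) (p : ℕ) :
    (adb D b s).L.act D (-(Ring.inverse (s.Ψ b) * s.S i p b 0))
      + ∑ c, (adb D b s).Φ c * (s.S i p c (shift b c 0)
        - s.S i p b 0 * (Ring.inverse (s.Ψ b) * s.chiStar D c (shift b c 0)))
      = -(Ring.inverse (s.Ψ b) * s.S i (p + 1) b 0) := by
  have hψ := Ring.mul_inverse_cancel _ hu
  have hσ : D (s.S i p b 0) = s.chi D i p * s.Ψ b := hs.prim i p b 0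
  have hb := hs.bilinear i p b 0
  have hc := System.res_chiStar_mul (D := D) s b 0
  simp only [show s.chiStar D b 0 = s.Ψ b from rfl, zero_add] at hb hc
  rw [act_eq_res, ofPDO_adb_L]
  have e : (C D (-Ring.inverse (s.Ψ b)) * Xi D * C D (s.Ψ b)) * ofPDO D s.L *
      (C D (-Ring.inverse (s.Ψ b)) * X D * C D (s.Ψ b)) *
      C D (-(Ring.inverse (s.Ψ b) * s.S i p b 0)) * Xi D
      = C D (-Ring.inverse (s.Ψ b)) * (Xi D * C D (s.Ψ b) * ofPDO D s.L *
          C D (Ring.inverse (s.Ψ b) * s.S i p b 0)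
        + Xi D * C D (s.Ψ b) * ofPDO D s.L * C D (s.chi D i p) * Xi D) := by
    calc _ = C D (-Ring.inverse (s.Ψ b)) * (Xi D * C D (s.Ψ b) * ofPDO D s.L *
      (C D (-Ring.inverse (s.Ψ b)) * X D * C D (s.Ψ b) *
      C D (-(Ring.inverse (s.Ψ b) * s.S i p b 0)) * Xi D)) := by simp only [mul_assoc]
      _ = _ := by
        rw [adjGauge_mul_C hψ hσ, mul_add]
        simp only [mul_assoc]
  rw [e, coeff_C_mul, coeff_add, ← hb, res_mul_C, hc,
    sum_eq_sum_add_sub b (F := fun c => (adb D b s).Φ c * (s.S i p c (shift b c 0)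
        - s.S i p b 0 * (Ring.inverse (s.Ψ b) * s.chiStar D c (shift b c 0))))
      (G := fun c => (0 - Ring.inverse (s.Ψ b) * s.S c 0 b 0) *
      (s.S i p c 0 - s.S i p b 0 * Ring.inverse (s.Ψ b) * s.Ψ c)), sum_sub_mul_sub,
    adb_Φ_self, shift_self]
  · have hcomm : ∑ c, s.S i p c 0 * s.S c 0 b 0 = ∑ c, s.S c 0 b 0 * s.S i p c 0 :=
      Finset.sum_congr rfl fun c _ => mul_comm _ _
    rw [hcomm]
    simp only [zero_mul, mul_zero, Finset.sum_const_zero, zero_add]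
    linear_combination (-(Ring.inverse (s.Ψ b) * s.S b 0 b 0 * s.S i p b 0)) * hψ
  · intro c hc
    rw [adb_Φ_of_ne hc, shift_of_ne hc, show s.chiStar D c 0 = s.Ψ c from rfl]
    ring

/-- Entry point of the eigenfunction tower at `b`, which now begins with -1/Ψ_b. -/
theorem adb_act_inv (hu : IsUnit (s.Ψ b)) :
    (adb D b s).L.act D (-Ring.inverse (s.Ψ b))
      + ∑ c, (adb D b s).Φ c * -(Ring.inverse (s.Ψ b) * s.chiStar D c (shift b c 0))
      = -(Ring.inverse (s.Ψ b) * s.S b 0 b 0) := by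
  have hψ := Ring.mul_inverse_cancel _ hu
  have hc := System.res_chiStar_mul (D := D) s b 0
  simp only [show s.chiStar D b 0 = s.Ψ b from rfl, zero_add] at hc
  rw [act_eq_res, ofPDO_adb_L]
  have e : (C D (-Ring.inverse (s.Ψ b)) * Xi D * C D (s.Ψ b)) * ofPDO D s.L *
      (C D (-Ring.inverse (s.Ψ b)) * X D * C D (s.Ψ b)) *
      C D (-Ring.inverse (s.Ψ b)) * Xi D
      = C D (-Ring.inverse (s.Ψ b)) * (Xi D * C D (s.Ψ b) * ofPDO D s.L *
          C D (Ring.inverse (s.Ψ b))) := by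
    calc _ = C D (-Ring.inverse (s.Ψ b)) * (Xi D * C D (s.Ψ b) * ofPDO D s.L *
      (C D (-Ring.inverse (s.Ψ b)) * X D * C D (s.Ψ b) *
      C D (-Ring.inverse (s.Ψ b)) * Xi D)) := by simp only [mul_assoc]
      _ = _ := by rw [adjGauge_mul_C_inv hψ]
  rw [e, coeff_C_mul, res_mul_C, hc,
    sum_eq_sum_add_sub b
      (F := fun c => (adb D b s).Φ c * -(Ring.inverse (s.Ψ b) * s.chiStar D c (shift b c 0)))
      (G := fun c => Ring.inverse (s.Ψ b) ^ 2 * (s.Ψ c * s.S c 0 b 0)),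
    ← Finset.mul_sum, adb_Φ_self, shift_self]
  · linear_combination (-(Ring.inverse (s.Ψ b) * s.S b 0 b 0)) * hψ
  · intro c hc
    rw [adb_Φ_of_ne hc, shift_of_ne hc, show s.chiStar D c 0 = s.Ψ c from rfl]
    ring

/-- `χ_i^{(k)}` of the transformed system, `i ≠ b`. -/
theorem chi_adb_of_ne (hs : s.IsStatic D r) (hu : IsUnit (s.Ψ b)) {i : Fin m} (hi : i ≠ b)
    (k : ℕ) : (adb D b s).chi D i k = -(Ring.inverse (s.Ψ b) * s.S i k b 0) := by
  induction k with
  | zero => exact adb_Φ_of_ne hi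
  | succ k ih =>
    rw [System.chi, ih, ← adb_act_step hs hu]
    simp only [adb_S_of_ne hi]

theorem chi_adb_self_succ (hs : s.IsStatic D r) (hu : IsUnit (s.Ψ b)) (k : ℕ) :
    (adb D b s).chi D b (k + 1) = -(Ring.inverse (s.Ψ b) * s.S b k b 0) := by
  induction k with
  | zero =>
    rw [System.chi, System.chi, adb_Φ_self, ← adb_act_inv (D := D) hu]
    simp only [adb_S_self_zero]
  | succ k ih =>
    rw [System.chi, ih, ← adb_act_step hs hu]
    simp only [adb_S_self_succ]

theorem chi_adb_self_zero : (adb D b s).chi D b 0 = -Ring.inverse (s.Ψ b) := adb_Φ_self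

theorem isPrimitive_adb (hs : s.IsStatic D r) (hu : IsUnit (s.Ψ b)) :
    (adb D b s).IsPrimitive D := by
  intro i k j l
  have hψ := Ring.mul_inverse_cancel _ hu
  rw [chiStar_adb hs hu, gauge]
  have key : ∀ i p, D (s.S i p j (shift b j l)
      - s.S i p b 0 * (Ring.inverse (s.Ψ b) * s.chiStar D j (shift b j l)))
      = -(Ring.inverse (s.Ψ b) * s.S i p b 0) *
        (s.Ψ b * D (Ring.inverse (s.Ψ b) * s.chiStar D j (shift b j l))) := fun i p => by
    have h0 : s.chiStar D b 0 = s.Ψ b := rfl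
    rw [map_sub, hs.prim, D.leibniz (s.S i p b 0), smul_eq_mul, smul_eq_mul, hs.prim, h0]
    linear_combination (D (Ring.inverse (s.Ψ b) * s.chiStar D j (shift b j l)) * s.S i p b 0
      - s.chi D i p * s.chiStar D j (shift b j l)) * hψ
  by_cases hi : i = b
  · subst hi
    cases k with
    | zero =>
      rw [adb_S_self_zero, chi_adb_self_zero, map_neg]
      linear_combination D (Ring.inverse (s.Ψ i) * s.chiStar D j (shift i j l)) * hψ
    | succ k => rw [adb_S_self_succ, chi_adb_self_succ hs hu, key]
  · rw [adb_S_of_ne hi, chi_adb_of_ne hs hu hi, key]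

/-- Here the conjugation replaces `g` by two terms on the left, and `adjGauge_mul_C` does so for `f`
on the right. The exceptional label is (b, 0) on the eigenfunction side, with function -1/Ψ_b. -/
theorem bilinear_adb (hs : s.IsStatic D r) (hu : IsUnit (s.Ψ b)) (i : Fin m) (k : ℕ) (j : Fin m)
    (l : ℕ) : (adb D b s).S i (k + 1) j l - (adb D b s).S i k j (l + 1)
        - ∑ c, (adb D b s).S i k c 0 * (adb D b s).S c 0 j l =
      (Xi D * C D ((adb D b s).chiStar D j l) * ofPDO D (adb D b s).L *
        C D ((adb D b s).chi D i k) * Xi D).coeff (-1) := by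
  have hψ := Ring.mul_inverse_cancel _ hu
  set ψ := s.Ψ b with hψdef
  set ψi := Ring.inverse ψ with hψi
  set g := s.chiStar D j (shift b j l) with hg
  have h0 : s.chiStar D b 0 = ψ := rfl
  have e (F : R) : Xi D * C D ((adb D b s).chiStar D j l) * ofPDO D (adb D b s).L * C D F * Xi D
      = Xi D * C D g * ofPDO D s.L * (C D (-ψi) * X D * C D ψ * C D F * Xi D)
        - C D (ψi * g) * (Xi D * C D ψ * ofPDO D s.L *
          (C D (-ψi) * X D * C D ψ * C D F * Xi D)) := by
    rw [ofPDO_adb_L, chiStar_adb hs hu, gauge]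
    calc _ = Xi D * C D (ψ * D (ψi * g)) * (C D (-ψi) * Xi D * C D ψ) * ofPDO D s.L *
          (C D (-ψi) * X D * C D ψ * C D F * Xi D) := by simp only [mul_assoc]; rfl
      _ = _ := by
        rw [Xi_mul_C_gauge_mul_adjGaugeInv hψ, sub_mul, sub_mul]; simp only [mul_assoc]
  have hcg := System.res_chiStar_mul (D := D) s j (shift b j l)
  have hcb := System.res_chiStar_mul (D := D) s b 0
  rw [← hg] at hcg
  rw [h0, zero_add] at hcb
  have key : ∀ i p, s.S i (p + 1) j (shift b j l) - s.S i (p + 1) b 0 * (ψi * g)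
      - (s.S i p j (shift b j l + 1) - s.S i p b 0 * (ψi * s.chiStar D j (shift b j l + 1)))
      - ∑ c, (s.S i p c (shift b c 0) - s.S i p b 0 * (ψi * s.chiStar D c (shift b c 0))) *
        (adb D b s).S c 0 j l
      = (Xi D * C D ((adb D b s).chiStar D j l) * ofPDO D (adb D b s).L *
        C D (-(ψi * s.S i p b 0)) * Xi D).coeff (-1) := fun i p => by
    have hσ : D (s.S i p b 0) = s.chi D i p * ψ := hs.prim i p b 0
    have hbg := hs.bilinear i p j (shift b j l)
    have hbb := hs.bilinear i p b 0
    rw [h0, zero_add] at hbb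
    rw [← hg] at hbg
    rw [e, adjGauge_mul_C hψ hσ, coeff_sub, coeff_C_mul, mul_add, mul_add, coeff_add, coeff_add,
      res_mul_C, res_mul_C, ← mul_assoc _ (C D (s.chi D i p)) (Xi D),
      ← mul_assoc _ (C D (s.chi D i p)) (Xi D), ← hbg, ← hbb, hcg, hcb,
      sum_eq_sum_add_sub b
        (F := fun c => (s.S i p c (shift b c 0) - s.S i p b 0 * (ψi * s.chiStar D c (shift b c 0)))
          * (adb D b s).S c 0 j l)
        (G := fun c => (s.S i p c 0 - s.S i p b 0 * ψi * s.Ψ c) *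
        (s.S c 0 j (shift b j l) - ψi * g * s.S c 0 b 0)), sum_sub_mul_sub, adb_S_self_zero,
        shift_self]
    · have hcomm : ∀ x y : Fin m → R, ∑ c, x c * y c = ∑ c, y c * x c := fun x y =>
        Finset.sum_congr rfl fun c _ => mul_comm _ _
      rw [hcomm (fun c => s.S c 0 b 0) (fun c => s.S i p c 0),
        hcomm (fun c => s.S c 0 b 0) (fun c => s.Ψ c)]
      linear_combination (-s.S i p b 0 * (s.S b 0 j (shift b j l) - ψi * g * s.S b 0 b 0)) * hψ
    · intro c hc
      rw [adb_S_of_ne hc, shift_of_ne hc, show s.chiStar D c 0 = s.Ψ c from rfl]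
      ring
  by_cases hi : i = b
  · cases k with
    | zero =>
      rw [hi, chi_adb_self_zero, e, adjGauge_mul_C_inv hψ, coeff_sub, coeff_C_mul, res_mul_C,
        res_mul_C, hcg, hcb,
        sum_eq_sum_add_sub b (F := fun c => (adb D b s).S b 0 c 0 * (adb D b s).S c 0 j l)
          (G := fun c => -ψi * (s.Ψ c * s.S c 0 j (shift b j l))
          + ψi * (ψi * g) * (s.Ψ c * s.S c 0 b 0)), Finset.sum_add_distrib, ← Finset.mul_sum,
        ← Finset.mul_sum, adb_S_self_zero, adb_S_self_zero, adb_S_self_zero, adb_S_self_succ,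
        shift_self, shift_succ]
      · linear_combination (-(s.S b 0 j (shift b j l) - ψi * g * s.S b 0 b 0)) * hψ
      · intro c hc
        rw [adb_S_of_ne hc, adb_S_self_zero, shift_of_ne hc,
          show s.chiStar D c 0 = s.Ψ c from rfl]
        ring
    | succ k =>
      rw [hi, chi_adb_self_succ hs hu, ← key]
      simp only [adb_S_self_succ, shift_succ]
      rfl
  · rw [chi_adb_of_ne hs hu hi, ← key]
    simp only [adb_S_of_ne hi, shift_succ]
    rfl

/-- The terms beginning with Ψ_b⁻¹ D⁻¹ combine into one with right factor built from L^*(Ψ_b); the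
others are the transformed pairs, with zero at `b` because T̄(Ψ_b) = 0. -/
theorem hasLaxForm_adb (hs : s.IsStatic D r) (hu : IsUnit (s.Ψ b)) :
    (adb D b s).HasLaxForm D r := by
  have hψ := Ring.mul_inverse_cancel _ hu
  have hψ' := Ring.inverse_mul_cancel _ hu
  have ho : OrdLe (ofPDO D (adb D b s).L) r := by
    rw [ofPDO_adb_L]
    have := ((((ordLe_C (D := D) (-Ring.inverse (s.Ψ b))).mul ordLe_Xi).mul
      (ordLe_C (s.Ψ b))).mul hs.form.ordLe).mul
        (((ordLe_C (-Ring.inverse (s.Ψ b))).mul ordLe_X).mul (ordLe_C (s.Ψ b)))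
    exact this.mono (by omega)
  have hU : C D (-Ring.inverse (s.Ψ b)) * X D * C D (s.Ψ b)
      = -(X D + C D (Ring.inverse (s.Ψ b) * D (s.Ψ b))) := by
    rw [C_X_C, neg_mul, neg_mul, hψ', C_neg, C_neg, C_one, neg_mul, one_mul, neg_add]
  -- The intertwining runs from the new operator to the old one, so the known leading coefficient
  -- belongs to the second operator.
  have hint : (X D + C D (Ring.inverse (s.Ψ b) * D (s.Ψ b))) * ofPDO D (adb D b s).L
      = ofPDO D s.L * (X D + C D (Ring.inverse (s.Ψ b) * D (s.Ψ b))) := by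
    have : (C D (-Ring.inverse (s.Ψ b)) * X D * C D (s.Ψ b)) * ofPDO D (adb D b s).L
        = ofPDO D s.L * (C D (-Ring.inverse (s.Ψ b)) * X D * C D (s.Ψ b)) := by
      rw [ofPDO_adb_L, mul_assoc _ (ofPDO D s.L), ← mul_assoc, adjGauge_mul_adjGaugeInv hψ, one_mul]
    rwa [hU, neg_mul, mul_neg, neg_inj] at this
  obtain ⟨h1, h2⟩ := top_coeffs_of_intertwine ho hs.form.ordLe (Or.inr hs.form.lead) hint
  refine System.hasLaxForm_of (h1.symm.trans hs.form.lead) (h2.symm.trans hs.form.sub) ho ?_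
  have hc : s.chiStar D b 1 = s.L.actAdj D (s.chiStar D b 0) - ∑ c, s.Ψ c * s.S c 0 b 0 := rfl
  rw [← actAdj_plus, actAdj_eq_res, show s.chiStar D b 0 = s.Ψ b from rfl] at hc
  have hdiff := adjGauge_conj_diff (ψ := s.Ψ b) (ψi := Ring.inverse (s.Ψ b))
    (isDiff_plus (D := D) s.L)
  have hp : ∀ c, D (s.S c 0 b 0) = s.Φ c * s.Ψ b := fun c => hs.prim c 0 b 0
  convert hdiff using 1
  rw [ofPDO_adb_L, hs.form.eq_add, mul_add, add_mul, Finset.mul_sum, Finset.sum_mul]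
  rw [Finset.sum_congr rfl fun c _ =>
      adjGauge_conj_rankOne (v := s.Ψ c) (ψi := Ring.inverse (s.Ψ b)) (hp c),
    Finset.sum_sub_distrib, ← Finset.mul_sum, ← C_sum,
    sum_eq_sum_add_sub b (F := fun c => C D ((adb D b s).Φ c) * Xi D * C D ((adb D b s).Ψ c))
      (G := fun c => -(C D (Ring.inverse (s.Ψ b) * s.S c 0 b 0) * Xi D *
        C D (gauge D (s.Ψ b) (s.Ψ c))))]
  · rw [adb_Ψ, shift_self, adb_Φ_self, gauge_self hu, C_zero, zero_add, hc, gauge_sub, C_sub,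
      gauge_sum, Finset.sum_neg_distrib, C_neg]
    simp only [gauge]
    generalize (Xi D * C D (s.Ψ b) * ofPDO D s.L.plus).coeff (-1) = q
    noncomm_ring
  · intro c hc
    rw [adb_Ψ, shift_of_ne hc, adb_Φ_of_ne hc, C_neg, neg_mul, neg_mul]
    rfl

theorem isStatic_adb (hs : s.IsStatic D r) (hu : IsUnit (s.Ψ b)) : (adb D b s).IsStatic D r :=
  ⟨hasLaxForm_adb hs hu, isPrimitive_adb hs hu, bilinear_adb hs hu⟩

end ADB

/-! ### Wronskians -/

section Wronskian

variable {D : Derivation ℚ R R}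

/-- Coefficients of `∂^n ∘ φ` as a differential operator. -/
def leibnizCoeff (D : Derivation ℚ R R) (φ : R) : ℕ → ℕ → R
  | 0, k => if k = 0 then φ else 0
  | n + 1, 0 => D (leibnizCoeff D φ n 0)
  | n + 1, k + 1 => D (leibnizCoeff D φ n (k + 1)) + leibnizCoeff D φ n k

theorem leibnizCoeff_of_lt (φ : R) {n k : ℕ} (h : n < k) : leibnizCoeff D φ n k = 0 := by
  induction n generalizing k with
  | zero => exact if_neg (by omega)
  | succ n ih =>
    obtain ⟨k, rfl⟩ := Nat.exists_eq_succ_of_ne_zero (by omega : k ≠ 0)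
    rw [leibnizCoeff, ih (by omega), ih (by omega), map_zero, add_zero]

theorem leibnizCoeff_self (φ : R) (n : ℕ) : leibnizCoeff D φ n n = φ := by
  induction n with
  | zero => rfl
  | succ n ih => rw [leibnizCoeff, ih, leibnizCoeff_of_lt φ (by omega), map_zero, zero_add]

theorem iterate_mul_eq_sum (φ h : R) {n N : ℕ} (hn : n < N) :
    D^[n] (φ * h) = ∑ k ∈ Finset.range N, leibnizCoeff D φ n k * D^[k] h := by
  induction n with
  | zero =>
    rw [Finset.sum_eq_single 0]
    · rfl
    · intro k _ hk
      rw [leibnizCoeff, if_neg hk, zero_mul]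
    · intro h0
      exact absurd (Finset.mem_range.2 hn) h0
  | succ n ih =>
    obtain ⟨N, rfl⟩ := Nat.exists_eq_succ_of_ne_zero (by omega : N ≠ 0)
    have hlast : leibnizCoeff D φ n N = 0 := leibnizCoeff_of_lt φ (by omega)
    have e : ∑ k ∈ Finset.range (N + 1), D (leibnizCoeff D φ n k) * D^[k] h
        + ∑ k ∈ Finset.range (N + 1), leibnizCoeff D φ n k * D^[k + 1] h
        = ∑ k ∈ Finset.range (N + 1), leibnizCoeff D φ (n + 1) k * D^[k] h := by
      rw [Finset.sum_range_succ (fun k => leibnizCoeff D φ n k * _), hlast, zero_mul, add_zero,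
        Finset.sum_range_succ', Finset.sum_range_succ' (fun k => leibnizCoeff D φ (n + 1) k * _),
        add_right_comm, ← Finset.sum_add_distrib]
      congr 1
      refine Finset.sum_congr rfl fun k _ => ?_
      rw [leibnizCoeff, add_mul]
    rw [Function.iterate_succ_apply', ih (by omega), map_sum, ← e, ← Finset.sum_add_distrib]
    refine Finset.sum_congr rfl fun k _ => ?_
    rw [D.leibniz, smul_eq_mul, smul_eq_mul, Function.iterate_succ_apply', add_comm]
    ring

/-- The matrix with first rows `∂^α f`, `α < p`, and further rows `c`. -/
def bordered {N : ℕ} (D : Derivation ℚ R R) (p : ℕ) (f : Fin N → R) (c : Fin N → Fin N → R) :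
    Matrix (Fin N) (Fin N) R :=
  Matrix.of fun α β => if α.val < p then D^[α.val] (f β) else c α β

/-- By the Leibniz rule, multiplying all functions by φ acts on the rows through a lower triangular
matrix with diagonal φ on the `p` derivative rows and 1 on the bordering rows. -/
theorem det_bordered_mul {N : ℕ} {p : ℕ} (hp : p ≤ N) (φ : R) (h : Fin N → R)
    (c : Fin N → Fin N → R) :
    (bordered D p (fun β => φ * h β) c).det = φ ^ p * (bordered D p h c).det := by
  let B : Matrix (Fin N) (Fin N) R := Matrix.of fun α γ =>
    if α.val < p then leibnizCoeff D φ α γ else if α = γ then 1 else 0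
  have hB : bordered D p (fun β => φ * h β) c = B * bordered D p h c := by
    ext α β
    rw [Matrix.mul_apply]
    simp only [bordered, B, Matrix.of_apply]
    by_cases hα : α.val < p
    · simp only [if_pos hα]
      rw [iterate_mul_eq_sum φ (h β) α.isLt, ← Fin.sum_univ_eq_sum_range
        (fun k => leibnizCoeff D φ α k * D^[k] (h β))]
      refine Finset.sum_congr rfl fun γ _ => ?_
      by_cases hγ : γ.val < p
      · rw [if_pos hγ]
      · rw [leibnizCoeff_of_lt φ (by omega), zero_mul, zero_mul]
    · simp only [if_neg hα]
      rw [Finset.sum_eq_single α (fun γ _ hγ => by rw [if_neg hγ.symm, zero_mul])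
        fun h => absurd (Finset.mem_univ _) h, if_pos rfl, one_mul, if_neg hα]
  have hdet : B.det = φ ^ p := by
    rw [Matrix.det_of_isLowerTriangular B]
    · have : ∀ α : Fin N, B α α = if α.val < p then φ else 1 := fun α => by
        simp only [B, Matrix.of_apply, leibnizCoeff_self, if_true]
      rw [Finset.prod_congr rfl fun α _ => this α,
        Fin.prod_univ_eq_prod_range (fun k => if k < p then φ else 1) N, Finset.prod_ite,
        Finset.prod_const, Finset.prod_const_one, mul_one]
      congr 1
      have : (Finset.range N).filter (· < p) = Finset.range p := by
        ext k; simp only [Finset.mem_filter, Finset.mem_range]; omega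
      rw [this, Finset.card_range]
    · intro α γ hαγ
      have hlt : α < γ := hαγ
      simp only [B, Matrix.of_apply]
      split_ifs with h1 h2
      · exact leibnizCoeff_of_lt φ hlt
      · exact absurd h2 hlt.ne
      · rfl
  rw [hB, Matrix.det_mul, hdet]

theorem det_eq_of_row_zero {R : Type*} [CommRing R] {N : ℕ} (A : Matrix (Fin (N + 1)) (Fin (N + 1)) R)
    (h0 : A 0 0 = 1) (h : ∀ β : Fin N, A 0 β.succ = 0) :
    A.det = (A.submatrix Fin.succ Fin.succ).det := by
  rw [Matrix.det_succ_row_zero, Fin.sum_univ_succ, Finset.sum_eq_zero fun β _ => by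
    rw [h β, mul_zero, zero_mul]]
  simp [h0]

/-- Removing the first column of a bordered matrix. -/
theorem det_bordered_cons {N : ℕ} {p : ℕ} (hp : p ≤ N) {φ : R} (hu : IsUnit φ) (f : Fin N → R)
    (c : Fin (N + 1) → Fin (N + 1) → R) :
    (bordered D (p + 1) (Fin.cons φ f) c).det = φ * (bordered D p (fun β => gauge D φ (f β))
      fun α β => c α.succ β.succ - Ring.inverse φ * f β * c α.succ 0).det := by
  -- Factoring out φ makes the first function 1, whose column has zeros in the later derivative
  -- rows.
  have h1 : (Fin.cons φ f : Fin (N + 1) → R)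
      = fun β => φ * (Fin.cons 1 (fun β => Ring.inverse φ * f β) : Fin (N + 1) → R) β := by
    funext β
    refine Fin.cases ?_ (fun β => ?_) β
    · simp
    · simp [Ring.mul_inverse_cancel_left _ _ hu]
  rw [h1, det_bordered_mul (by omega)]
  set A := bordered D (p + 1)
    (Fin.cons 1 (fun β => Ring.inverse φ * f β) : Fin (N + 1) → R) c with hA
  -- Column operations clearing the first row to (1, 0, …, 0); in the bordering rows they produce c
  -- - (f/φ) c₀, the transformation law of the potentials.
  let v : Fin (N + 1) → R := Fin.cons 0 fun β => -(Ring.inverse φ * f β)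
  let A' : Matrix (Fin (N + 1)) (Fin (N + 1)) R := Matrix.of fun α β => A α β + v β * A α 0
  have hdet : A'.det = A.det := by
    rw [← Matrix.det_transpose A', ← Matrix.det_transpose A]
    exact Matrix.det_eq_of_forall_row_eq_smul_add_const v 0 rfl fun _ _ => rfl
  rw [← hdet, det_eq_of_row_zero A']
  -- Of the factor φ^{p+1}, the power φ^p is absorbed into T(f) = φ ∂(f/φ), leaving one φ.
  · have hg : (fun β => gauge D φ (f β)) = fun β => φ * D (Ring.inverse φ * f β) := rfl
    rw [hg, det_bordered_mul hp, ← mul_assoc, ← pow_succ']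
    congr 2
    ext α β
    simp only [A', A, v, bordered, Matrix.submatrix_apply, Matrix.of_apply, Fin.cons_succ,
      Fin.cons_zero, Fin.val_succ, Nat.add_lt_add_iff_right]
    split_ifs with h
    · rw [Psi.iterate_one (Nat.succ_ne_zero _), mul_zero, add_zero, Function.iterate_succ_apply]
    · ring
  · simp [A', A, v, bordered]
  · intro β
    simp [A', A, v, bordered]

theorem wronskian_ofFn {N : ℕ} (f : Fin N → R) (c : Fin N → Fin N → R) :
    wronskian D (List.ofFn f) = (bordered D N f c).det := by
  rw [wronskian, ← Matrix.det_submatrix_equiv_self (finCongr (List.length_ofFn (f := f)).symm)]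
  congr 1
  ext α β
  simp [bordered, -List.ofFn_succ]

/-- Crum's recursion: removing the first function replaces the others by their images under `T`,
which is what a DB step does to the χ's. -/
theorem wronskian_cons {φ : R} (hu : IsUnit φ) (fs : List R) :
    wronskian D (φ :: fs) = φ * wronskian D (fs.map (gauge D φ)) := by
  obtain ⟨N, f, rfl⟩ : ∃ N, ∃ f : Fin N → R, List.ofFn f = fs := ⟨_, _, List.ofFn_get fs⟩
  have h : φ :: List.ofFn f = List.ofFn (Fin.cons φ f : Fin (N + 1) → R) := by
    rw [List.ofFn_cons]
  rw [h, List.map_ofFn, wronskian_ofFn _ 0, det_bordered_cons le_rfl hu, wronskian_ofFn]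
  rfl

theorem wronskian_map_mul (h : R) (fs : List R) :
    wronskian D (fs.map fun f => h * f) = h ^ fs.length * wronskian D fs := by
  obtain ⟨N, f, rfl⟩ : ∃ N, ∃ f : Fin N → R, List.ofFn f = fs := ⟨_, _, List.ofFn_get fs⟩
  rw [List.map_ofFn, wronskian_ofFn _ 0, wronskian_ofFn f 0, List.length_ofFn]
  exact det_bordered_mul le_rfl h f 0

theorem wronskian_nil : wronskian D ([] : List R) = 1 := by
  rw [wronskian]
  exact Matrix.det_fin_zero

theorem wronskianTilde_nil (g : R) : wronskianTilde D [] g = -g := if_pos rfl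

theorem wronskianTilde_ofFn {N : ℕ} (f : Fin (N + 1) → R × R) (g : R) :
    wronskianTilde D (List.ofFn f) g
      = (bordered D N (fun β => (f β).1) fun _ β => (f β).2).det := by
  rw [wronskianTilde, if_neg (by simp),
    ← Matrix.det_submatrix_equiv_self (finCongr (List.length_ofFn (f := f)).symm)]
  congr 1
  ext α β
  simp [bordered, -List.ofFn_succ]

/-- The last row changes exactly as S(T(f), T^{*-1}(g)) does, and `g` becomes -σ/φ. The value -g for
the empty list makes the recursion hold for a one-element list. -/
theorem wronskianTilde_cons {φ : R} (hu : IsUnit φ) (σ g : R) (ps : List (R × R)) :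
    wronskianTilde D ((φ, σ) :: ps) g = φ * wronskianTilde D
      (ps.map fun p => (gauge D φ p.1, p.2 - Ring.inverse φ * p.1 * σ))
      (-(Ring.inverse φ * σ)) := by
  obtain ⟨N, f, rfl⟩ : ∃ N, ∃ f : Fin N → R × R, List.ofFn f = ps := ⟨_, _, List.ofFn_get ps⟩
  have h : (φ, σ) :: List.ofFn f = List.ofFn (Fin.cons (φ, σ) f : Fin (N + 1) → R × R) := by
    rw [List.ofFn_cons]
  rw [h, List.map_ofFn, wronskianTilde_ofFn]
  cases N with
  | zero =>
    rw [List.ofFn_zero, wronskianTilde_nil, neg_neg, Ring.mul_inverse_cancel_left _ _ hu,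
      Matrix.det_fin_one]
    rfl
  | succ N =>
    have h1 : (fun β => ((Fin.cons (φ, σ) f : Fin (N + 2) → R × R) β).1)
        = Fin.cons φ fun β => (f β).1 := by
      funext β
      exact Fin.cases rfl (fun _ => rfl) β
    rw [wronskianTilde_ofFn, h1, det_bordered_cons (Nat.le_succ N) hu]
    rfl

end Wronskian

/-! ### Sequences of steps -/

section Run

variable {m : ℕ} {D : Derivation ℚ R R} {r : ℕ}

/-- The labels of the functions by which the steps with the given indices divide. -/
def pivotLabels : List (Fin m) → List (Fin m × ℕ)
  | [] => []
  | a :: xs => (a, 0) :: (pivotLabels xs).map fun p => (p.1, shift a p.1 p.2)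

theorem fst_mem_of_mem_pivotLabels {xs : List (Fin m)} {p : Fin m × ℕ}
    (h : p ∈ pivotLabels xs) : p.1 ∈ xs := by
  induction xs generalizing p with
  | nil => simp [pivotLabels] at h
  | cons a xs ih =>
    rw [pivotLabels, List.mem_cons, List.mem_map] at h
    rcases h with rfl | ⟨q, hq, rfl⟩
    · exact List.mem_cons_self
    · exact List.mem_cons_of_mem _ (ih (p := q) hq)

/-- Repeated steps in `i` climb the tower of `i` one label at a time and leave the labels of other
indices alone; `hi` keeps later steps from meeting this tower again. -/
theorem pivotLabels_replicate_append {xs : List (Fin m)} {i : Fin m} (hi : i ∉ xs) (n : ℕ) :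
    pivotLabels (List.replicate n i ++ xs)
      = ((List.range n).map fun l => (i, l)) ++ pivotLabels xs := by
  induction n with
  | zero => rfl
  | succ n ih =>
    have h : (pivotLabels xs).map (fun p => (p.1, shift i p.1 p.2)) = pivotLabels xs := by
      conv_rhs => rw [← List.map_id (pivotLabels xs)]
      refine List.map_congr_left fun p hp => ?_
      rw [shift_of_ne]
      · rfl
      · rintro rfl
        exact hi (fst_mem_of_mem_pivotLabels hp)
    rw [List.replicate_succ, List.cons_append, pivotLabels, ih, List.map_append, h,
      List.range_succ_eq_map, List.map_cons, List.map_map, List.map_map, List.cons_append]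
    congr 3
    funext l
    simp

theorem pivotLabels_flatMap (n : Fin m → ℕ) {l : List (Fin m)} (hl : l.Nodup) :
    pivotLabels (l.flatMap fun i => List.replicate (n i) i)
      = l.flatMap fun i => (List.range (n i)).map fun k => (i, k) := by
  induction l with
  | nil => rfl
  | cons i l ih =>
    rw [List.nodup_cons] at hl
    rw [List.flatMap_cons, List.flatMap_cons, pivotLabels_replicate_append, ih hl.2]
    rw [List.mem_flatMap]
    rintro ⟨j, hj, hij⟩
    rw [List.eq_of_mem_replicate hij] at hl
    exact hl.1 hj

/-- The indices of the steps, `n i` times each `i`. -/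
def stepIndices (n : Fin m → ℕ) : List (Fin m) :=
  (List.finRange m).flatMap fun i => List.replicate (n i) i

theorem pivotLabels_stepIndices (n : Fin m → ℕ) : pivotLabels (stepIndices n) = labels n :=
  pivotLabels_flatMap n (List.nodup_finRange m)

theorem ne_zero_of_mem_stepIndices {n : Fin m → ℕ} {i : Fin m} (h : i ∈ stepIndices n) :
    n i ≠ 0 := by
  obtain ⟨j, _, hj⟩ := List.mem_flatMap.1 h
  obtain ⟨h0, rfl⟩ := List.mem_replicate.1 hj
  exact h0

theorem length_labels (n : Fin m → ℕ) : (labels n).length = ∑ i, n i := by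
  rw [labels, List.length_flatMap]
  simp only [List.length_map, List.length_range]
  rw [← List.ofFn_eq_map, List.sum_ofFn]

theorem steps_eq (n k : Fin m → ℕ) :
    steps n k = (stepIndices n).map Step.db ++ (stepIndices k).map Step.adb := by
  simp only [steps, stepIndices, List.map_flatMap, List.map_replicate]

theorem run_append (xs ys : List (Step m)) (s : System m R) :
    run D (xs ++ ys) s = run D ys (run D xs s) := by
  induction xs generalizing s with
  | nil => rfl
  | cons x xs ih => exact ih _

theorem admissible_append {xs ys : List (Step m)} {s : System m R} :
    Admissible D (xs ++ ys) s ↔ Admissible D xs s ∧ Admissible D ys (run D xs s) := by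
  induction xs generalizing s with
  | nil => simp [Admissible, run]
  | cons x xs ih =>
    rw [List.cons_append, Admissible, Admissible, ih, and_assoc]
    rfl

/-- Induction by splitting off the first step: the determinants of the remaining steps, taken in the
transformed system, are pulled back by `wronskian_cons` and `wronskianTilde_cons`. The formula for
the adjoint functions is restricted to j ∉ xs, where no label shift of χ_j^* takes place. -/
theorem run_db {xs : List (Fin m)} {s : System m R} (hs : s.IsStatic D r)
    (hadm : Admissible D (xs.map Step.db) s) :
    (run D (xs.map Step.db) s).IsStatic D r ∧
    IsUnit (wronskian D ((pivotLabels xs).map fun p => s.chi D p.1 p.2)) ∧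
    (run D (xs.map Step.db) s).τ
      = wronskian D ((pivotLabels xs).map fun p => s.chi D p.1 p.2) * s.τ ∧
    ∀ j, j ∉ xs → ∀ l, wronskian D ((pivotLabels xs).map fun p => s.chi D p.1 p.2)
        * (run D (xs.map Step.db) s).chiStar D j l
      = -wronskianTilde D ((pivotLabels xs).map fun p => (s.chi D p.1 p.2, s.S p.1 p.2 j l))
          (s.chiStar D j l) := by
  induction xs generalizing s with
  | nil =>
    simp only [pivotLabels, List.map_nil, wronskian_nil, wronskianTilde_nil, run]
    exact ⟨hs, isUnit_one, (one_mul _).symm, fun j _ l => by rw [one_mul, neg_neg]⟩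
  | cons a xs ih =>
    obtain ⟨hu, hadm⟩ := hadm
    change IsUnit (s.Φ a) at hu
    change Admissible D (xs.map Step.db) (db D a s) at hadm
    obtain ⟨h1, h2, h3, h4⟩ := ih (isStatic_db hs hu) hadm
    have hW : wronskian D ((pivotLabels (a :: xs)).map fun p => s.chi D p.1 p.2)
        = s.Φ a * wronskian D ((pivotLabels xs).map fun p => (db D a s).chi D p.1 p.2) := by
      rw [pivotLabels, List.map_cons, show s.chi D a 0 = s.Φ a from rfl, wronskian_cons hu,
        List.map_map, List.map_map]
      congr 3
      funext p
      exact (chi_db hs hu p.1 p.2).symm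
    refine ⟨h1, ?_, ?_, fun j hj l => ?_⟩
    · rw [hW]
      exact hu.mul h2
    · rw [hW]
      refine h3.trans ?_
      rw [show (db D a s).τ = s.Φ a * s.τ from rfl]
      ring
    · rw [List.mem_cons, not_or] at hj
      rw [hW, mul_assoc]
      refine (congrArg (s.Φ a * ·) (h4 j hj.2 l)).trans ?_
      rw [pivotLabels, List.map_cons, show s.chi D a 0 = s.Φ a from rfl, wronskianTilde_cons hu,
        List.map_map, List.map_map, mul_neg, chiStar_db_of_ne hs hu hj.1]
      congr 4
      funext p
      simp only [Function.comp_apply, chi_db hs hu, db_S_of_ne hj.1]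

/-- An adjoint step acts on all χ_j^{*(l)} by T̄ up to the label shift, so Crum's recursion applies
to them directly. -/
theorem run_adb {ys : List (Fin m)} {s : System m R} (hs : s.IsStatic D r)
    (hadm : Admissible D (ys.map Step.adb) s) :
    (run D (ys.map Step.adb) s).IsStatic D r ∧
    (run D (ys.map Step.adb) s).τ
      = wronskian D ((pivotLabels ys).map fun p => s.chiStar D p.1 p.2) * s.τ := by
  induction ys generalizing s with
  | nil =>
    simp only [pivotLabels, List.map_nil, wronskian_nil, run]
    exact ⟨hs, (one_mul _).symm⟩
  | cons b ys ih =>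
    obtain ⟨hu, hadm⟩ := hadm
    change IsUnit (s.Ψ b) at hu
    change Admissible D (ys.map Step.adb) (adb D b s) at hadm
    obtain ⟨h1, h2⟩ := ih (isStatic_adb hs hu) hadm
    refine ⟨h1, h2.trans ?_⟩
    rw [pivotLabels, List.map_cons, show s.chiStar D b 0 = s.Ψ b from rfl, wronskian_cons hu,
      List.map_map, List.map_map, show (adb D b s).τ = s.Ψ b * s.τ from rfl, ← mul_assoc,
      mul_comm _ (s.Ψ b)]
    congr 4
    funext p
    exact chiStar_adb hs hu p.1 p.2

end Run

/-- A system of the `cKP` hierarchy with normalized potentials is static. -/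
theorem IsCKP.isStatic {m : ℕ} {d : ℕ → Derivation ℚ R R} {r : ℕ} (hr : 1 ≤ r)
    {s : System m R} {Q : PDO R} (hs : IsCKP d r s Q) (hnorm : IsNormalized d r s) :
    s.IsStatic (d 1) r where
  form := hs.form
  prim i k j l := by
    have hpow : PDO.pow (d 1) Q 1 = Q := one_mul (ofPDO (d 1) Q)
    have hQ : OrdLe (ofPDO (d 1) Q) 1 := hs.root.high
    have hZ : OrdLe (C (d 1) (s.chiStar (d 1) j l) * ofPDO (d 1) Q) 1 := by
      simpa using (ordLe_C _).mul hQ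
    have hY : OrdLe (Xi (d 1) * (C (d 1) (s.chiStar (d 1) j l) * ofPDO (d 1) Q)) 0 := by
      simpa using ordLe_Xi.mul hZ
    -- The leading coefficient of D⁻¹ g Q is `g`, because `Q` is monic of order one; hence the flux
    -- of the first flow is g f.
    have hlead := coeff_X_mul (Xi (d 1) * (C (d 1) (s.chiStar (d 1) j l) * ofPDO (d 1) Q)) 1
    rw [X_Xi_assoc, hY 1 one_pos, map_zero, add_zero, coeff_C_mul, coeff_ofPDO, hs.root.lead,
      mul_one, sub_self] at hlead
    rw [hs.sep 1 le_rfl, hpow, sepFlux_plus_eq_res, coeff_mul_Xi, neg_add_cancel, mul_assoc (Xi _),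
      coeff_mul_C_of_ordLe hY, ← hlead, mul_comm]
  bilinear i k j l := by
    -- For the flow `t_r` the operator Q^r is `L` itself, so both expressions for ∂S/∂t_r can be
    -- equated.
    rw [← hnorm i k j l, hs.sep r hr, hs.root.pow_eq, sepFlux_plus_eq_res]

end CKP

end

/-! ### The tau-function after DB steps followed by adjoint steps -/

theorem mainTheorem11 {R : Type*} [CommRing R] [Algebra ℚ R]
    (d : ℕ → Derivation ℚ R R)
    (hcomm : ∀ i j, 1 ≤ i → 1 ≤ j → ∀ f, d i (d j f) = d j (d i f))
    (r m : ℕ) (hr : 1 ≤ r)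
    (s : CKP.System m R) (Q : CKP.PDO R)
    (hs : CKP.IsCKP d r s Q) (hnorm : CKP.IsNormalized d r s)
    (a : ℕ) (ha : a ≤ m) (n k : Fin m → ℕ)
    (hn : ∀ i : Fin m, a ≤ i.val → n i = 0)
    (hk : ∀ i : Fin m, i.val < a → k i = 0)
    (hadm : CKP.Admissible (d 1) (CKP.steps n k) s) :
    (CKP.run (d 1) (CKP.steps n k) s).HasLaxForm (d 1) r ∧
    (CKP.run (d 1) (CKP.steps n k) s).IsPrimitive (d 1) ∧
    IsUnit (CKP.chiWronskian (d 1) s n) ∧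
    (CKP.run (d 1) (CKP.steps n k) s).τ =
      CKP.chiWronskian (d 1) s n
        * Ring.inverse (-CKP.chiWronskian (d 1) s n) ^ (∑ i, k i)
        * CKP.wronskian (d 1) ((CKP.labels k).map fun p => CKP.Delta (d 1) s n p.1 p.2)
        * s.τ := by
  rw [CKP.steps_eq, CKP.admissible_append] at hadm
  obtain ⟨h1, h2, h3, h4⟩ := CKP.run_db (hs.isStatic hr hnorm) hadm.1
  obtain ⟨h5, h6⟩ := CKP.run_adb h1 hadm.2
  rw [CKP.pivotLabels_stepIndices] at h2 h3 h4 h6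
  rw [CKP.steps_eq, CKP.run_append]
  refine ⟨h5.form, h5.prim, h2, ?_⟩
  -- The functions whose Wronskian the adjoint steps produce are those of the system already
  -- transformed by the DB steps; in terms of the original data they are -Δ/W_n.
  have hchi : ∀ p ∈ CKP.labels k,
      (CKP.run (d 1) ((CKP.stepIndices n).map CKP.Step.db) s).chiStar (d 1) p.1 p.2
        = Ring.inverse (-CKP.chiWronskian (d 1) s n) * CKP.Delta (d 1) s n p.1 p.2 := by
    intro p hp
    rw [← CKP.pivotLabels_stepIndices] at hp
    have hpk := CKP.ne_zero_of_mem_stepIndices (CKP.fst_mem_of_mem_pivotLabels hp)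
    -- An index with k_i ≠ 0 satisfies i ≥ a, so it never occurs among the DB steps.
    have hpn : p.1 ∉ CKP.stepIndices n := fun h =>
      CKP.ne_zero_of_mem_stepIndices h (hn p.1 (not_lt.1 fun h' => hpk (hk p.1 h')))
    have e := h4 p.1 hpn p.2
    have hu : IsUnit (-CKP.chiWronskian (d 1) s n) := IsUnit.neg h2
    have e' : CKP.Delta (d 1) s n p.1 p.2 = -CKP.chiWronskian (d 1) s n *
        (CKP.run (d 1) ((CKP.stepIndices n).map CKP.Step.db) s).chiStar (d 1) p.1 p.2 := by
      rw [neg_mul]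
      exact (neg_eq_iff_eq_neg.2 e).symm
    rw [e', Ring.inverse_mul_cancel_left _ _ hu]
  have hmap : (CKP.labels k).map (fun p =>
      (CKP.run (d 1) ((CKP.stepIndices n).map CKP.Step.db) s).chiStar (d 1) p.1 p.2)
      = ((CKP.labels k).map fun p => CKP.Delta (d 1) s n p.1 p.2).map
        fun f => Ring.inverse (-CKP.chiWronskian (d 1) s n) * f := by
    rw [List.map_map]
    exact List.map_congr_left hchi
  -- The common factor leaves the Wronskian to the power given by its number of functions, ∑ k_i.
  rw [h6, hmap, CKP.wronskian_map_mul, List.length_map, CKP.length_labels, h3]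
  change _ * (CKP.chiWronskian (d 1) s n * _) = _
  ring
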